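/- Let $\mathbb F$ be a field with $\operatorname{char}\mathbb F\neq 2,3$. Let $f_E,f_Q\in\mathbb F[x_0,x_1,x_2]$ be homogeneous of degrees $3$ and $2$, such that the plane cubic $E=\{f_E=0\}$ is smooth. In $\mathbb P^3$ with coordinates $x_0,\dots,x_3$ let $H=\{x_3=0\}\cong\mathbb P^2\supset E$, let $Q_2=\{f_Q+x_3^2=0\}$, let $Q_3=\{f_E=0\}$ be the cone over $E$ with vertex $(0:0:0:1)$, and assume that $Y=Q_2\cap Q_3$ is integral, i.e. that the ideal $(f_Q+x_3^2,\,f_E)$ is prime. Let $q_Y:Y\to E$ be the projection from the vertex, $i:x_3\mapsto -x_3$ its involution, and $R$ the ramification divisor of $q_Y$, i.e. the divisor of the sheaf of relative differentials $\Omega_{Y/E}$. Denote by $\Omega_Y$ the canonical (dualizing) sheaf of $Y$, described by duality for $q_Y$: its sections over $q_Y^{-1}(U)$ are the rational differentials $\omega$ on $Y$ such that $b\omega+i^*(b\omega)$ is the pull-back of a regular differential on $U\subset E$ for every $b\in\mathcal O_Y(q_Y^{-1}(U))$. Write $H^0(Y,\Omega_Y)_{\mathrm{even}}$, $H^0(Y,\Omega_Y)_{\mathrm{odd}}$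 for the subspaces on which $i^*$ acts as $1$, respectively $-1$, and $|K_Y|=\mathbb P(H^0(Y,\Omega_Y))$; a point $[\omega]$ of it has the zero divisor $(\omega)_0$. Then: 0. If $Y$ is smooth, then $\Omega_Y$ is the sheaf of Kähler differentials of $Y$ over $\mathbb F$ (on the charts $x_0\ne0$, $x_1\neq 0$, $x_2\neq0$ of $Y$, inside the rational differentials). 1. $H^0(Y,\Omega_Y)_{\mathrm{even}}$ is one-dimensional, and the divisor of its non-zero elements is $R$. 2. There is a linear isomorphism from the space of linear forms in $x_0,\dots,x_3$ to $H^0(Y,\Omega_Y)$ whose projectivization $(\mathbb P^3)^*\to|K_Y|$ sends each plane $H'$ to the unique point of $|K_Y|$ with divisor $Y\cap H'$. Under this identification, $\mathbb P(H^0(Y,\Omega_Y)_{\mathrm{even}})\subset|K_Y|$ is the point dual to $H$. 3. $H^0(Y,\Omega_Y)_{\mathrm{odd}}$ is three-dimensional. 4. Under the same identification, $\mathbb P(H^0(Y,\Omega_Y)_{\mathrm{odd}})\subset|K_Y|$ is the set of planes in $\mathbb P^3$ through the vertex of $Q_3$. 5. For every line $L\subset H$ there is a unique point $\phi_Y(L)\in\mathbb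 P(H^0(Y,\Omega_Y)_{\mathrm{odd}})$ with divisor $q_Y^*(L\cap E)$, and the map $\phi_Y:H^*\to\mathbb P(H^0(Y,\Omega_Y)_{\mathrm{odd}})$ so defined is an isomorphism of projective spaces, i.e. the projectivization of a linear isomorphism. -/

import Mathlib

open MvPolynomial
open scoped KaehlerDifferential LinearAlgebra.Projectivization TensorProduct

noncomputable section

namespace CanonicalModel

/-! ### Pull-back of Kähler differentials -/

section Differentials

variable {F A B : Type*} [Field F] [CommRing A] [Algebra F A] [CommRing B] [Algebra F B]

theorem ideal_le_comap (f : A →ₐ[F] B) :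
    KaehlerDifferential.ideal F A ≤
      (KaehlerDifferential.ideal F B).comap (Algebra.TensorProduct.map f f) := by
  rw [← KaehlerDifferential.span_range_eq_ideal, Ideal.span_le]
  rintro _ ⟨a, rfl⟩
  simp

/-- The pull-back of Kähler differentials `Ω[A⁄F] → Ω[B⁄F]`, `a dc ↦ f(a) d(f(c))`, along an
algebra homomorphism `f : A → B`.  Here `Ω[A⁄F]` is `I/I²`, with `I` the kernel of the
multiplication `A ⊗ A → A`, and the map is the one induced by `f ⊗ f`. -/
def pullback (f : A →ₐ[F] B) : Ω[A⁄F] →ₗ[F] Ω[B⁄F] :=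
  Ideal.mapCotangent (KaehlerDifferential.ideal F A) (KaehlerDifferential.ideal F B)
    (Algebra.TensorProduct.map f f) (ideal_le_comap f)

theorem pullback_D (f : A →ₐ[F] B) (a : A) :
    pullback f (KaehlerDifferential.D F A a) = KaehlerDifferential.D F B (f a) := by
  rw [KaehlerDifferential.D_apply, KaehlerDifferential.D_apply]
  refine (Ideal.mapCotangent_toCotangent _ _ _ _ _).trans ?_
  congr 1
  ext
  simp

theorem pullback_smul (f : A →ₐ[F] B) (a : A) (ω : Ω[A⁄F]) :
    pullback f (a • ω) = f a • pullback f ω := by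
  obtain ⟨x, rfl⟩ := KaehlerDifferential.fromIdeal_surjective F A ω
  rw [algebra_compatible_smul (A ⊗[F] A) a, ← map_smul,
    algebra_compatible_smul (B ⊗[F] B) (f a)]
  refine (Ideal.mapCotangent_toCotangent _ _ _ _ _).trans ?_
  refine Eq.trans ?_ (map_smul (KaehlerDifferential.fromIdeal F B) _ _)
  refine congrArg (KaehlerDifferential.fromIdeal F B) ?_
  refine Subtype.ext ?_
  refine (map_mul (Algebra.TensorProduct.map f f) _ _).trans ?_
  simp only [Algebra.TensorProduct.algebraMap_apply, Algebra.TensorProduct.map_tmul, map_one,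
    Algebra.algebraMap_self_apply]
  rfl

/-- For an `F`-subalgebra `A` of `K`, the image of `Ω[A⁄F]` in `Ω[K⁄F]`: the differentials
`∑ aᵢ dbᵢ` with `aᵢ, bᵢ ∈ A`. -/
def kaehlerImage {K : Type*} [Field K] [Algebra F K] (A : Subalgebra F K) :
    Submodule A Ω[K⁄F] :=
  LinearMap.range (KaehlerDifferential.map F F A K)

/-- The annihilator of the module of relative differentials `Ω[B⁄A]` of a ring homomorphism
`A → B`.  (When this module is generated by one element, as for a double cover, it is `B / I` with
`I` this ideal, which is also its zeroth Fitting ideal.) -/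
def relativeDifferent {A B : Type*} [CommRing A] [CommRing B] (f : A →+* B) : Ideal B :=
  letI : Algebra A B := f.toAlgebra
  Module.annihilator B Ω[B⁄A]

end Differentials

/-! ### The curves `E ⊆ H = ℙ²` and `Y = Q₂ ∩ Q₃ ⊆ ℙ³` -/

section Curves

variable {F : Type*} [Field F]

/-- A form in `x₀, x₁, x₂`, regarded as a form in `x₀, x₁, x₂, x₃` (the cone over its zero set,
with vertex `(0 : 0 : 0 : 1)`). -/
def cone (f : MvPolynomial (Fin 3) F) : MvPolynomial (Fin 4) F := rename Fin.castSucc f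

/-- The equation `f_Q + x₃²` of the quadric surface `Q₂`. -/
def quadric (fQ : MvPolynomial (Fin 3) F) : MvPolynomial (Fin 4) F := cone fQ + X 3 ^ 2

/-- The homogeneous ideal of `Y = Q₂ ∩ Q₃`. -/
def idealY (fQ fE : MvPolynomial (Fin 3) F) : Ideal (MvPolynomial (Fin 4) F) :=
  Ideal.span {quadric fQ, cone fE}

/-- The plane curve `f_E = 0` is smooth (Jacobian criterion at all geometric points). -/
def IsSmoothPlaneCurve (fE : MvPolynomial (Fin 3) F) : Prop :=
  ∀ v : Fin 3 → AlgebraicClosure F, v ≠ 0 → aeval v fE = 0 → ∃ j, aeval v (pderiv j fE) ≠ 0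

/-- `Y` is smooth (Jacobian criterion at all geometric points). -/
def IsSmoothY (fQ fE : MvPolynomial (Fin 3) F) : Prop :=
  ∀ v : Fin 4 → AlgebraicClosure F, v ≠ 0 → aeval v (quadric fQ) = 0 → aeval v (cone fE) = 0 →
    LinearIndependent (AlgebraicClosure F)
      ![fun j => aeval v (pderiv j (quadric fQ)), fun j => aeval v (pderiv j (cone fE))]

variable (fQ fE : MvPolynomial (Fin 3) F)

/-- The homogeneous coordinate ring of `Y`. -/
abbrev CoordRing : Type _ := MvPolynomial (Fin 4) F ⧸ idealY fQ fE

/-- The substitution `x₃ ↦ -x₃` on polynomials. -/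
def negLast : MvPolynomial (Fin 4) F →ₐ[F] MvPolynomial (Fin 4) F :=
  aeval fun j => if j = 3 then -X 3 else X j

theorem negLast_cone (f : MvPolynomial (Fin 3) F) : negLast (cone f) = cone f := by
  have h : (negLast.comp (rename Fin.castSucc) :
      MvPolynomial (Fin 3) F →ₐ[F] MvPolynomial (Fin 4) F) = rename Fin.castSucc := by
    ext j
    fin_cases j <;> simp [negLast]
  exact DFunLike.congr_fun h f

theorem negLast_quadric (f : MvPolynomial (Fin 3) F) : negLast (quadric f) = quadric f := by
  simp only [quadric, map_add, negLast_cone, map_pow]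
  simp [negLast]

theorem negLast_negLast (p : MvPolynomial (Fin 4) F) : negLast (negLast p) = p := by
  have h : (negLast.comp negLast : MvPolynomial (Fin 4) F →ₐ[F] _) = AlgHom.id F _ := by
    ext j
    by_cases hj : j = 3 <;> simp [negLast, hj]
  exact DFunLike.congr_fun h p

theorem idealY_le_comap : idealY fQ fE ≤ (idealY fQ fE).comap negLast := by
  rw [idealY, Ideal.span_le]
  rintro p (rfl | rfl)
  · simpa [negLast_quadric] using Ideal.subset_span (by simp)
  · simpa [negLast_cone] using Ideal.subset_span (by simp)

/-- The involution `x₃ ↦ -x₃` of the homogeneous coordinate ring. -/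
def involutionCoord : CoordRing fQ fE →ₐ[F] CoordRing fQ fE :=
  Ideal.quotientMapₐ _ negLast (idealY_le_comap fQ fE)

theorem involutionCoord_mk (p : MvPolynomial (Fin 4) F) :
    involutionCoord fQ fE (Ideal.Quotient.mk _ p) = Ideal.Quotient.mk _ (negLast p) := rfl

theorem involutionCoord_injective : Function.Injective (involutionCoord fQ fE) := by
  have h : Function.Involutive (involutionCoord fQ fE) := by
    intro x
    obtain ⟨p, rfl⟩ := Ideal.Quotient.mk_surjective x
    rw [involutionCoord_mk, involutionCoord_mk, negLast_negLast]
  exact h.injective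

/-- The field of fractions of the homogeneous coordinate ring. -/
abbrev ConeField : Type _ := FractionRing (CoordRing fQ fE)

theorem involutionCone_aux : Function.Injective
    ((IsScalarTower.toAlgHom F (CoordRing fQ fE) (ConeField fQ fE)).comp
      (involutionCoord fQ fE)) := by
  rw [AlgHom.coe_comp]
  exact (IsFractionRing.injective (CoordRing fQ fE) (ConeField fQ fE)).comp
    (involutionCoord_injective fQ fE)

/-! From here on `Y` is integral. -/

variable [(idealY fQ fE).IsPrime]

/-- The homogeneous coordinate `xⱼ`. -/
def coord (j : Fin 4) : ConeField fQ fE :=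
  algebraMap (CoordRing fQ fE) _ (Ideal.Quotient.mk _ (X j))

/-- The function field of `Y`: the field generated over `F` by the quotients `xⱼ / xₖ`. -/
def functionField : IntermediateField F (ConeField fQ fE) :=
  IntermediateField.adjoin F (Set.range fun p : Fin 4 × Fin 4 => coord fQ fE p.1 / coord fQ fE p.2)

/-- The rational function `xⱼ / xₖ` on `Y`. -/
def ratio (j k : Fin 4) : functionField fQ fE :=
  ⟨coord fQ fE j / coord fQ fE k, IntermediateField.subset_adjoin F _ ⟨(j, k), rfl⟩⟩

/-- The involution `x₃ ↦ -x₃` of the field of fractions of the homogeneous coordinate ring. -/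
def involutionCone : ConeField fQ fE →ₐ[F] ConeField fQ fE :=
  IsFractionRing.liftAlgHom (K := ConeField fQ fE) (involutionCone_aux fQ fE)

theorem involutionCone_coord (j : Fin 4) :
    involutionCone fQ fE (coord fQ fE j) = if j = 3 then -coord fQ fE 3 else coord fQ fE j := by
  have h : involutionCone fQ fE (coord fQ fE j) =
      algebraMap (CoordRing fQ fE) _ (Ideal.Quotient.mk _ (negLast (X j))) := by
    rw [involutionCone, coord, IsFractionRing.liftAlgHom_apply, IsFractionRing.lift_algebraMap]
    rfl
  rw [h]
  by_cases hj : j = 3 <;> simp [negLast, hj, coord]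

theorem involutionCone_mem (x : functionField fQ fE) :
    involutionCone fQ fE x ∈ functionField fQ fE := by
  have h : functionField fQ fE ≤ (functionField fQ fE).comap (involutionCone fQ fE) := by
    rw [functionField, IntermediateField.adjoin_le_iff]
    rintro _ ⟨⟨j, k⟩, rfl⟩
    have hr := (ratio fQ fE j k).2
    have hn := neg_mem hr
    simp only [ratio] at hr hn
    change involutionCone fQ fE (coord fQ fE j / coord fQ fE k) ∈ functionField fQ fE
    rw [map_div₀, involutionCone_coord, involutionCone_coord]
    by_cases hj : j = 3 <;> by_cases hk : k = 3 <;> subst_vars <;>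
      simp_all [neg_div, div_neg]
  exact h x.2

/-- The involution `i` of `Y` over `E`, `i (x₀ : x₁ : x₂ : x₃) = (x₀ : x₁ : x₂ : -x₃)`,
acting on the function field of `Y`. -/
def involution : functionField fQ fE →ₐ[F] functionField fQ fE :=
  ((involutionCone fQ fE).comp (functionField fQ fE).val).codRestrict
    (functionField fQ fE).toSubalgebra (involutionCone_mem fQ fE)

/-- Rational differentials on `Y`. -/
abbrev RatDiff : Type _ := Ω[functionField fQ fE⁄F]

/-- The action `i^*` of the involution on rational differentials. -/
def involutionDiff : RatDiff fQ fE →ₗ[F] RatDiff fQ fE := pullback (involution fQ fE)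

/-- The coordinate ring of the affine open set `xᵢ ≠ 0` of `Y`, generated by the `xⱼ / xᵢ`.
The three charts with `i ≤ 2` cover `Y`, since the vertex `(0 : 0 : 0 : 1)` is not on `Q₂`. -/
def chartY (i : Fin 3) : Subalgebra F (functionField fQ fE) :=
  Algebra.adjoin F (Set.range fun j : Fin 4 => ratio fQ fE j i.castSucc)

/-- The coordinate ring of the affine open set `xᵢ ≠ 0` of the plane curve `E`, regarded as a
subring of the function field of `Y` by means of `q_Y : Y → E`, the projection from the vertex;
its inverse image in `Y` is the chart `xᵢ ≠ 0` of `Y`. -/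
def chartE (i : Fin 3) : Subalgebra F (functionField fQ fE) :=
  Algebra.adjoin F (Set.range fun j : Fin 3 => ratio fQ fE j.castSucc i.castSucc)

theorem chartE_le_chartY (i : Fin 3) : chartE fQ fE i ≤ chartY fQ fE i :=
  Algebra.adjoin_mono (by rintro _ ⟨j, rfl⟩; exact ⟨j.castSucc, rfl⟩)

theorem ratio_mem_chartY (j : Fin 4) (i : Fin 3) :
    ratio fQ fE j i.castSucc ∈ chartY fQ fE i :=
  Algebra.subset_adjoin ⟨j, rfl⟩

theorem ratio_mem_chartE (j i : Fin 3) :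
    ratio fQ fE j.castSucc i.castSucc ∈ chartE fQ fE i :=
  Algebra.subset_adjoin ⟨j, rfl⟩

/-! ### Differentials on `Y` -/

/-- The sections of the dualizing sheaf of `Y` on the chart `xᵢ ≠ 0`, given by duality for the
double cover `Y → E` of the smooth curve `E`: the rational differentials `ω` such that
`Tr (b ω) = b ω + i^* (b ω)` is (the pull-back of) a regular differential on the chart of `E`, for
every regular function `b` on the chart of `Y`.  If `Y` is smooth this is the sheaf of Kähler
differentials, if `Y` has nodes it is the sheaf of differentials on the normalization that have at
most simple poles, with opposite residues, at the two points above each node. -/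
def canonicalSections (i : Fin 3) : Submodule (chartY fQ fE i) (RatDiff fQ fE) where
  carrier := {ω | ∀ b : chartY fQ fE i,
    b • ω + involutionDiff fQ fE (b • ω) ∈ kaehlerImage (chartE fQ fE i)}
  add_mem' := by
    intro ω η hω hη b
    have h := add_mem (hω b) (hη b)
    rw [smul_add, map_add]
    convert h using 1
    abel
  zero_mem' := by
    intro b
    simp
  smul_mem' := by
    intro c ω hω b
    rw [smul_smul]
    exact hω (b * c)

/-- The space `H⁰(Y, Ω_Y)` of global differentials. -/
def globalDiff : Submodule F (RatDiff fQ fE) :=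
  ⨅ i : Fin 3, (canonicalSections fQ fE i).restrictScalars F

/-- The even differentials: `i^* ω = ω`. -/
def evenDiff : Submodule F (globalDiff fQ fE) :=
  (LinearMap.ker (involutionDiff fQ fE - LinearMap.id)).comap (globalDiff fQ fE).subtype

/-- The odd differentials: `i^* ω = -ω`. -/
def oddDiff : Submodule F (globalDiff fQ fE) :=
  (LinearMap.ker (involutionDiff fQ fE + LinearMap.id)).comap (globalDiff fQ fE).subtype

/-! ### Divisors on `Y` -/

/-- An effective divisor on `Y`, or more generally a closed subscheme, given by its ideals on the
three charts. -/
abbrev ChartIdeals : Type _ := ∀ i : Fin 3, Ideal (chartY fQ fE i)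

/-- The zero divisor `(ω)₀` of a section `ω` of the canonical sheaf: its ideal `I` is given by
`I · Ω_Y = O_Y · ω`, that is, it consists of the functions `a` with `a · Ω_Y ⊆ O_Y · ω`. -/
def zeroDivisor (ω : RatDiff fQ fE) : ChartIdeals fQ fE := fun i =>
  (Submodule.span (chartY fQ fE i) {ω}).colon
    (canonicalSections fQ fE i : Set (RatDiff fQ fE))

/-- The divisor `Y ∩ H'` cut out by the plane `H' : c₀ x₀ + c₁ x₁ + c₂ x₂ + c₃ x₃ = 0`. -/
def planeSection (c : Fin 4 → F) : ChartIdeals fQ fE := fun i =>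
  Ideal.span {∑ j, c j • ⟨ratio fQ fE j i.castSucc, ratio_mem_chartY fQ fE j i⟩}

/-- The ramification divisor `R` of `q_Y : Y → E`: the divisor of the sheaf of relative
differentials `Ω_{Y/E}`. -/
def ramification : ChartIdeals fQ fE := fun i =>
  relativeDifferent (Subalgebra.inclusion (chartE_le_chartY fQ fE i)).toRingHom

/-- The divisor `q_Y^* (L ∩ E)` on `Y`, for the line `L : c₀ x₀ + c₁ x₁ + c₂ x₂ = 0` in `H`. -/
def lineSectionPullback (c : Fin 3 → F) : ChartIdeals fQ fE := fun i =>
  (Ideal.span {∑ j, c j •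
      (⟨ratio fQ fE j.castSucc i.castSucc, ratio_mem_chartE fQ fE j i⟩ : chartE fQ fE i)}).map
    (Subalgebra.inclusion (chartE_le_chartY fQ fE i))

/-! ### Linear systems

The dual of a projective space `ℙⁿ` is `ℙ F (Fin (n + 1) → F)`: a point of it is the hyperplane
`∑ cⱼ xⱼ = 0`, where `c` is any representative. -/

/-- The divisor of a point of `|K_Y| = ℙ (H⁰(Y, Ω_Y))`. -/
def canonicalDivisor (P : ℙ F (globalDiff fQ fE)) : ChartIdeals fQ fE :=
  zeroDivisor fQ fE (P.rep : globalDiff fQ fE)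

/-- The inclusion of the projectivization of a space of differentials in `|K_Y|`. -/
def inclusionK (V : Submodule F (globalDiff fQ fE)) : ℙ F V → ℙ F (globalDiff fQ fE) :=
  Projectivization.map V.subtype V.injective_subtype

/-- The plane `H : x₃ = 0`, as a point of the dual of `ℙ³`. -/
def planeH : ℙ F (Fin 4 → F) :=
  Projectivization.mk F (Pi.single 3 1) (by simp)

/-- The planes in `ℙ³` through the vertex `(0 : 0 : 0 : 1)` of the cone `Q₃`. -/
def planesThroughVertex : Set (ℙ F (Fin 4 → F)) :=
  {Λ | ∑ j, Λ.rep j * (Pi.single 3 1 : Fin 4 → F) j = 0}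

/-- The relation `P = φ_Y (L)`: the divisor of `P` is `q_Y^* (L ∩ E)`. -/
def IsPhi (L : ℙ F (Fin 3 → F)) (P : ℙ F (oddDiff fQ fE)) : Prop :=
  canonicalDivisor fQ fE (inclusionK fQ fE (oddDiff fQ fE) P) = lineSectionPullback fQ fE L.rep

end Curves

end CanonicalModel

end

/-!
Let `E` be the plane cubic `f_E = 0` and `q_Y : Y → E` the double cover with equation
`x₃² = -f_Q`.  On the chart `xᵢ ≠ 0` write `s = x₃ / xᵢ`, `A = O_E` and `B = O_Y = A ⊕ A s`
(`mem_chartY_iff`).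

The sheaf of differentials of a smooth plane cubic is trivial.  In the affine coordinates `u, v` of
a chart it is generated by `η = du / f_v = -dv / f_u`, and this differential does not depend on the
chart (`exists_isInvariantDifferential`).  Regularity and the absence of zeros come from the
Jacobian criterion through the Nullstellensatz (`exists_bezout_pderiv`).  That `η` is not zero in
the function field of `Y` follows from an explicit vector field on the cone over `Y`, given by
Jacobian determinants (`jacobianDerivation`).  Since `2` is invertible, the rational differentials
on `Y` are the multiples `g η`, and `i^*` sends `g η` to `i(g) η`.

The trace condition that defines the dualizing sheaf can now be solved: `g η` is a section on a
chart exactly if `g s ∈ B` (`IsInvariantDifferential.mem_canonicalSections`), so that the sheaf is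
generated by `η / s` there.  Three consequences are local.  The divisor of `(ℓ / x₃) η`, for a
linear form `ℓ`, is the section of `Y` by the plane `ℓ = 0`.  The relative differentials of
`B = A[s]` over `A` are `B / (s)`, so `R` is the section by `x₃ = 0` (`ramification_eq`).  Finally
`2 s ds = -dq` with `q = -s²`, so the Kähler differentials of `B` are the multiples of `η / s` by
the ideal generated by `s` and the derivative of `q`; this is the unit ideal if `Y` is smooth.

The global statement is that all sections are of the form `(ℓ / x₃) η`.  The even and odd parts of
`g` for a section `g η` are a regular function on `E` and a section of `𝒪_E(1)` divided by `x₃`.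
Regular functions on `E` are constant and sections of `𝒪_E(1)` are linear forms in `x₀, x₁, x₂`;
both follow from the exactness of the Koszul complex of `x₀ᴺ, x₁ᴺ, x₂ᴺ`
(`exists_common_quotient`, `exists_form_of_forall_chart`).  The same argument shows that regular
functions on `Y` are constant, whence a plane is determined by its section with `Y`
(`planeSection_eq_iff`).  The involution fixes `η` and changes the sign of `x₃`, so the even
differentials correspond to the multiples of `ℓ = x₃` and the odd ones to the forms without `x₃`.
-/

namespace CanonicalModel

/-! ### Forms in three and four variables -/

section Forms

theorem aeval_mul_of_isHomogeneous {σ F A : Type*} [Fintype σ] [CommRing F] [CommRing A]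
    [Algebra F A] {p : MvPolynomial σ F} {n : ℕ} (hp : p.IsHomogeneous n) (c : A) (v : σ → A) :
    aeval (fun j => c * v j) p = c ^ n * aeval v p := by
  rw [aeval_def, aeval_def, eval₂_eq', eval₂_eq', Finset.mul_sum]
  refine Finset.sum_congr rfl fun d hd => ?_
  have hdeg : ∑ i, d i = n := by
    have h := hp (mem_support_iff.mp hd)
    rwa [← Finsupp.degree_eq_sum, Finsupp.degree_eq_weight_one]
  simp_rw [mul_pow]
  rw [Finset.prod_mul_distrib, Finset.prod_pow_eq_pow_sum, hdeg]
  ring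

/-- The part of the exactness of a Koszul complex that computes sections of a twisted sheaf on the
punctured cone over `f = 0`: the local quotients `p i / a i` agree modulo `f`, and come from one
element `q`, as soon as `a 0, a 1, a 2` is a regular sequence and `f ≠ 0`. -/
theorem exists_common_quotient {P : Type*} [CommRing P] [IsDomain P] {a : Fin 3 → P}
    (h1 : ∀ x y, a 0 * x = a 1 * y → a 0 ∣ y)
    (h2 : ∀ x, (∃ u v, a 2 * x = a 0 * u + a 1 * v) → ∃ u v, x = a 0 * u + a 1 * v)
    (ha0 : a 0 ≠ 0) {f : P} (hf : f ≠ 0) {p : Fin 3 → P}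
    (hp : ∀ i j, f ∣ p i * a j - p j * a i) : ∃ q, ∀ i, f ∣ p i - a i * q := by
  obtain ⟨g01, h01⟩ := hp 0 1
  obtain ⟨g02, h02⟩ := hp 0 2
  obtain ⟨g12, h12⟩ := hp 1 2
  -- The three quotients `gᵢⱼ` satisfy the Koszul cocycle relation.
  have hc : a 2 * g01 = a 0 * (-g12) + a 1 * g02 := by
    apply mul_left_cancel₀ hf
    linear_combination (-a 2) * h01 + a 1 * h02 - a 0 * h12
  obtain ⟨u, v, huv⟩ := h2 g01 ⟨_, _, hc⟩
  subst huv
  obtain ⟨q, hq⟩ := h1 (p 1 + f * u) (p 0 - f * v) (by linear_combination -h01)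
  have hq1 : p 1 + f * u = a 1 * q := by
    apply mul_left_cancel₀ ha0
    linear_combination -h01 + a 1 * hq
  have hw0 : a 0 * (p 2 - a 2 * q) = f * (v * a 2 - g02) := by
    linear_combination -h02 + a 2 * hq
  have hw1 : a 1 * (p 2 - a 2 * q) = f * (-u * a 2 - g12) := by
    linear_combination -h12 + a 2 * hq1
  obtain ⟨w, hw⟩ := h1 (-u * a 2 - g12) (v * a 2 - g02) (by
    apply mul_left_cancel₀ hf
    linear_combination a 1 * hw0 - a 0 * hw1)
  refine ⟨q, fun i => ?_⟩
  match i with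
  | 0 => exact ⟨v, by linear_combination hq⟩
  | 1 => exact ⟨-u, by linear_combination hq1⟩
  | 2 =>
    refine ⟨w, mul_left_cancel₀ ha0 ?_⟩
    linear_combination hw0 + f * hw

variable {F : Type*} [Field F]

theorem X_pow_dvd_of_mul_eq {σ : Type*} {i j : σ} (hij : i ≠ j) (N : ℕ) (x y : MvPolynomial σ F)
    (h : X i ^ N * x = X j ^ N * y) : (X i ^ N : MvPolynomial σ F) ∣ y := by
  have hp : Prime (X i : MvPolynomial σ F) := X_prime
  have hn : ¬ (X i : MvPolynomial σ F) ∣ X j ^ N := fun hd => by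
    have hd' := hp.dvd_of_dvd_pow hd
    rw [X_dvd_X] at hd'
    simp_all
  exact hp.pow_dvd_of_dvd_mul_left N hn ⟨x, h.symm⟩

theorem mem_span_pair_X_pow_of_mul {σ : Type*} {i j k : σ} (hik : i ≠ k) (hjk : j ≠ k) (N : ℕ)
    (x : MvPolynomial σ F) (h : ∃ u v, X k ^ N * x = X i ^ N * u + X j ^ N * v) :
    ∃ u v, x = X i ^ N * u + X j ^ N * v := by
  classical
  have himg : (fun s => monomial s (1 : F)) '' {Finsupp.single i N, Finsupp.single j N} =
      ({X i ^ N, X j ^ N} : Set (MvPolynomial σ F)) := by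
    simp [Set.image_pair, X_pow_eq_monomial]
  have key : ∀ y : MvPolynomial σ F, y ∈ Ideal.span {X i ^ N, X j ^ N} ↔
      ∃ u v, y = X i ^ N * u + X j ^ N * v := fun y => by
    rw [Ideal.mem_span_pair]
    constructor
    · rintro ⟨a, b, rfl⟩
      exact ⟨a, b, by ring⟩
    · rintro ⟨a, b, rfl⟩
      exact ⟨a, b, by ring⟩
  rw [← key, ← himg, mem_ideal_span_monomial_image] at h ⊢
  intro d hd
  obtain ⟨s, hs, hle⟩ := h (Finsupp.single k N + d) (by
    rw [mem_support_iff, X_pow_eq_monomial, coeff_monomial_mul, one_mul]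
    exact mem_support_iff.mp hd)
  refine ⟨s, hs, ?_⟩
  rcases hs with rfl | rfl
  · rw [Finsupp.single_le_iff] at hle ⊢
    simpa [Finsupp.single_apply, hik.symm] using hle
  · rw [Finsupp.single_le_iff] at hle ⊢
    simpa [Finsupp.single_apply, hjk.symm] using hle

theorem cone_isHomogeneous {f : MvPolynomial (Fin 3) F} {n : ℕ} (hf : f.IsHomogeneous n) :
    (cone f).IsHomogeneous n :=
  hf.rename_isHomogeneous

theorem quadric_isHomogeneous {f : MvPolynomial (Fin 3) F} (hf : f.IsHomogeneous 2) :
    (quadric f).IsHomogeneous 2 :=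
  (cone_isHomogeneous hf).add (by simpa using (isHomogeneous_X F (3 : Fin 4)).pow 2)

theorem aeval_cone {A : Type*} [CommRing A] [Algebra F A] (v : Fin 4 → A)
    (p : MvPolynomial (Fin 3) F) : aeval v (cone p) = aeval (fun j => v j.castSucc) p := by
  rw [cone, aeval_rename]
  rfl

/-- The curve `Y` spans `ℙ³`: no linear form vanishes on it. -/
theorem eq_zero_of_sum_mem_idealY {fQ fE : MvPolynomial (Fin 3) F} (hQ : fQ.IsHomogeneous 2)
    (hE : fE.IsHomogeneous 3) {c : Fin 4 → F} (h : ∑ j, C (c j) * X j ∈ idealY fQ fE) :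
    c = 0 := by
  have hle : idealY fQ fE ≤ idealOfVars (Fin 4) F ^ 2 := by
    rw [idealY, Ideal.span_le]
    rintro p (rfl | rfl)
    · refine (mem_pow_idealOfVars_iff 2 _).mpr fun x hx => ?_
      rw [Finsupp.degree_eq_weight_one]
      exact (quadric_isHomogeneous hQ (mem_support_iff.mp hx)).ge
    · refine (mem_pow_idealOfVars_iff 2 _).mpr fun x hx => ?_
      rw [Finsupp.degree_eq_weight_one]
      exact le_trans (by norm_num) (cone_isHomogeneous hE (mem_support_iff.mp hx)).ge
  have h' := (mem_pow_idealOfVars_iff 2 _).mp (hle h)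
  ext j
  by_contra hj
  have hs := h' (Finsupp.single j 1) (by
    rw [mem_support_iff, coeff_sum]
    simpa [coeff_C_mul, coeff_X, Finsupp.single_left_inj] using hj)
  simp at hs

/-- Modulo `f_E`, the equation `x₃² + f_Q` is monic in `x₃`, so that it divides no nonzero
polynomial that does not involve `x₃`. -/
theorem map_eq_zero_of_cone_mem_idealY {R : Type*} [CommRing R] [Algebra F R]
    (m : MvPolynomial (Fin 3) F →ₐ[F] R) {fQ fE p : MvPolynomial (Fin 3) F} (hE : m fE = 0)
    (h : cone p ∈ idealY fQ fE) : m p = 0 := by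
  let t : Fin 4 → Polynomial R :=
    Fin.lastCases (motive := fun _ => Polynomial R) Polynomial.X fun i => Polynomial.C (m (X i))
  have hφ : ∀ q, aeval t (cone q) = Polynomial.C (m q) := fun q => by
    have hc : (aeval fun j : Fin 3 => t j.castSucc) =
        (Polynomial.CAlgHom (R := F) (A := R)).comp m := by
      ext j : 1
      simp [t]
    rw [aeval_cone, hc]
    rfl
  rw [idealY, Ideal.mem_span_pair] at h
  obtain ⟨a, b, hab⟩ := h
  have h1 := congrArg (aeval t) hab
  have hX : aeval t (X 3 : MvPolynomial (Fin 4) F) = Polynomial.X :=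
    (aeval_X _ (Fin.last 3)).trans (Fin.lastCases_last ..)
  rw [map_add, map_mul, map_mul, hφ, hφ, hE, quadric, map_add, hφ, map_pow, hX, map_zero,
    mul_zero, add_zero, add_comm (Polynomial.C _)] at h1
  by_contra hne
  have : Nontrivial R := ⟨_, _, hne⟩
  refine Polynomial.Monic.not_dvd_of_natDegree_lt
    (Polynomial.monic_X_pow_add_C (m fQ) two_ne_zero)
    (Polynomial.C_ne_zero.mpr hne) ?_ (Dvd.intro_left _ h1)
  rw [Polynomial.natDegree_X_pow_add_C, Polynomial.natDegree_C]
  norm_num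

theorem dvd_of_cone_mem_idealY {fQ fE p : MvPolynomial (Fin 3) F}
    (h : cone p ∈ idealY fQ fE) : fE ∣ p :=
  Ideal.mem_span_singleton.mp (Ideal.Quotient.eq_zero_iff_mem.mp
    (map_eq_zero_of_cone_mem_idealY (Ideal.Quotient.mkₐ F (Ideal.span {fE}))
      (Ideal.Quotient.eq_zero_iff_mem.mpr (Ideal.mem_span_singleton_self _)) h))

attribute [local instance] MvPolynomial.gradedAlgebra in
theorem dvd_homogeneousComponent_sub {f p q : MvPolynomial (Fin 3) F} {m d e : ℕ}
    (hf : f.IsHomogeneous m) {a : MvPolynomial (Fin 3) F} (ha : a.IsHomogeneous e)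
    (hp : p.IsHomogeneous (e + d)) (h : f ∣ p - a * q) :
    f ∣ p - a * homogeneousComponent d q := by
  classical
  have hI : (Ideal.span {f}).IsHomogeneous (homogeneousSubmodule (Fin 3) F) :=
    Ideal.homogeneous_span _ _ (fun x hx => ⟨m, by rwa [Set.mem_singleton_iff.mp hx]⟩)
  have h1 := homogeneousComponent_mem_of_mem hI (Ideal.mem_span_singleton.mpr h) (e + d)
  have h2 : homogeneousComponent (e + d) (a * q) = a * homogeneousComponent d q := by
    conv_lhs => rw [← sum_homogeneousComponent q, Finset.mul_sum, map_sum]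
    have h3 : ∀ i, homogeneousComponent (e + d) (a * homogeneousComponent i q) =
        if i = d then a * homogeneousComponent d q else 0 := fun i => by
      rw [homogeneousComponent_of_mem (ha.mul (homogeneousComponent_isHomogeneous i q))]
      by_cases hi : i = d
      · subst hi; simp
      · simp [hi, Ne.symm hi]
    simp_rw [h3]
    rw [Finset.sum_ite_eq']
    split_ifs with hd
    · rfl
    · rw [homogeneousComponent_eq_zero, mul_zero]
      simpa using hd
  rw [map_sub, homogeneousComponent_eq_self hp, h2] at h1
  exact Ideal.mem_span_singleton.mp h1

/-- The homogeneous coordinate ring of a plane curve `f = 0` is saturated: sections of `𝒪(n)` that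
are given on the charts `Xᵢ ≠ 0` by `pᵢ / Xᵢᴺ`, with compatible `pᵢ`, come from one form. -/
theorem exists_form_of_local {f : MvPolynomial (Fin 3) F} {m n N : ℕ} (hf : f.IsHomogeneous m)
    (hf0 : f ≠ 0) {p : Fin 3 → MvPolynomial (Fin 3) F} (hp : ∀ i, (p i).IsHomogeneous (N + n))
    (h : ∀ i j, f ∣ p i * X j ^ N - p j * X i ^ N) :
    ∃ q : MvPolynomial (Fin 3) F, q.IsHomogeneous n ∧ ∀ i, f ∣ p i - X i ^ N * q := by
  obtain ⟨q, hq⟩ := exists_common_quotient (a := fun i => (X i ^ N : MvPolynomial (Fin 3) F))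
    (X_pow_dvd_of_mul_eq (by decide) N)
    (mem_span_pair_X_pow_of_mul (by decide) (by decide) N)
    (pow_ne_zero _ (X_ne_zero 0)) hf0 h
  refine ⟨homogeneousComponent n q, homogeneousComponent_isHomogeneous n q, fun i => ?_⟩
  exact dvd_homogeneousComponent_sub hf (by simpa using (isHomogeneous_X F i).pow N) (hp i) (hq i)

/-- If a proper ideal of the coordinate ring of an affine variety contains the values of a family
of polynomials, then these polynomials have a common geometric zero on the variety. -/
theorem exists_geometric_zero {σ A : Type*} [Finite σ] [CommRing A] [Algebra F A]
    {t : σ → A} (ht : Algebra.adjoin F (Set.range t) = ⊤) {I : Ideal A} (hI : I ≠ ⊤) :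
    ∃ v : σ → AlgebraicClosure F, ∀ p : MvPolynomial σ F, aeval t p ∈ I → aeval v p = 0 := by
  obtain ⟨M, hM, hIM⟩ := Ideal.exists_le_maximal I hI
  let _ : Field (A ⧸ M) := Ideal.Quotient.field M
  have : Algebra.FiniteType F A := ⟨⟨(Set.finite_range t).toFinset, by simpa using ht⟩⟩
  have : Module.Finite F (A ⧸ M) := finite_of_finite_type_of_isJacobsonRing F (A ⧸ M)
  let ψ : A →ₐ[F] AlgebraicClosure F :=
    (IsAlgClosed.lift (R := F) (S := A ⧸ M) (M := AlgebraicClosure F)).comp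
      (Ideal.Quotient.mkₐ F M)
  refine ⟨fun j => ψ (t j), fun p hp => ?_⟩
  have h1 : aeval (fun j => ψ (t j)) p = ψ (aeval t p) := by
    rw [← AlgHom.comp_apply, comp_aeval]
  rw [h1]
  have h2 : Ideal.Quotient.mkₐ F M (aeval t p) = 0 := Ideal.Quotient.eq_zero_iff_mem.mpr (hIM hp)
  simp only [ψ, AlgHom.comp_apply, h2, map_zero]

theorem ne_zero_of_isSmoothPlaneCurve {fE : MvPolynomial (Fin 3) F}
    (hsm : IsSmoothPlaneCurve fE) : fE ≠ 0 := by
  rintro rfl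
  obtain ⟨j, hj⟩ := hsm (fun _ => 1) (fun h => one_ne_zero (congrFun h 0)) (by simp)
  simp at hj

theorem euler_aeval {A : Type*} [CommRing A] [Algebra F A] {f : MvPolynomial (Fin 3) F} {n : ℕ}
    (hf : f.IsHomogeneous n) {v : Fin 3 → A} (hv : aeval v f = 0) :
    ∑ j, v j * aeval v (pderiv j f) = 0 := by
  have h := congrArg (aeval v) hf.sum_X_mul_pderiv
  simpa [hv] using h

end Forms

/-! ### Rational functions on `Y` -/

section FunctionField

variable {F : Type*} [Field F] {fQ fE : MvPolynomial (Fin 3) F}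

theorem aeval_coord (p : MvPolynomial (Fin 4) F) :
    aeval (coord fQ fE) p = algebraMap (CoordRing fQ fE) _ (Ideal.Quotient.mk _ p) := by
  have h : (aeval (coord fQ fE) : MvPolynomial (Fin 4) F →ₐ[F] ConeField fQ fE) =
      (IsScalarTower.toAlgHom F (CoordRing fQ fE) (ConeField fQ fE)).comp
        (Ideal.Quotient.mkₐ F _) := by
    ext j
    simp [coord]
  exact DFunLike.congr_fun h p

variable (fQ fE) in
/-- The value of a polynomial in `x₀, x₁, x₂` as an element of the field of fractions of the
homogeneous coordinate ring of `Y`. -/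
noncomputable def evalCone : MvPolynomial (Fin 3) F →ₐ[F] ConeField fQ fE :=
  aeval fun j => coord fQ fE j.castSucc

theorem evalCone_X (j : Fin 3) : evalCone fQ fE (X j) = coord fQ fE j.castSucc :=
  aeval_X _ _

variable [(idealY fQ fE).IsPrime]

theorem aeval_coord_eq_zero {p : MvPolynomial (Fin 4) F} :
    aeval (coord fQ fE) p = 0 ↔ p ∈ idealY fQ fE := by
  rw [aeval_coord, FaithfulSMul.algebraMap_eq_zero_iff, Ideal.Quotient.eq_zero_iff_mem]

theorem evalCone_eq_zero {p : MvPolynomial (Fin 3) F} : evalCone fQ fE p = 0 ↔ fE ∣ p := by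
  have h : evalCone fQ fE p = aeval (coord fQ fE) (cone p) := (aeval_cone _ p).symm
  rw [h, aeval_coord_eq_zero]
  refine ⟨dvd_of_cone_mem_idealY, ?_⟩
  rintro ⟨q, rfl⟩
  rw [cone, map_mul]
  exact Ideal.mul_mem_right _ _ (Ideal.subset_span (by simp [cone]))

theorem coord_last_sq : coord fQ fE 3 ^ 2 = -evalCone fQ fE fQ := by
  have h : aeval (coord fQ fE) (quadric fQ) = 0 :=
    aeval_coord_eq_zero.mpr (Ideal.subset_span (by simp))
  rw [quadric, map_add, aeval_cone, map_pow, aeval_X] at h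
  exact eq_neg_of_add_eq_zero_right h

section Coord

variable (hQ : fQ.IsHomogeneous 2) (hE : fE.IsHomogeneous 3)
include hQ hE

theorem eq_zero_of_sum_coord {c : Fin 4 → F} (h : ∑ j, c j • coord fQ fE j = 0) : c = 0 := by
  refine eq_zero_of_sum_mem_idealY hQ hE (aeval_coord_eq_zero.mp ?_)
  simpa [Algebra.smul_def] using h

theorem coord_ne_zero (j : Fin 4) : coord fQ fE j ≠ 0 := fun h => by
  have h1 := eq_zero_of_sum_coord hQ hE (c := Pi.single j 1) (by
    simp [Pi.single_apply, ite_smul, h])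
  simpa using congrFun h1 j

theorem ratio_self (j : Fin 4) : ratio fQ fE j j = 1 :=
  Subtype.ext (div_self (coord_ne_zero hQ hE j))

theorem ratio_mul_ratio (j k l : Fin 4) :
    ratio fQ fE j k * ratio fQ fE k l = ratio fQ fE j l :=
  Subtype.ext (div_mul_div_cancel₀ (coord_ne_zero hQ hE k))

theorem ratio_ne_zero (j k : Fin 4) : ratio fQ fE j k ≠ 0 := fun h =>
  div_ne_zero (coord_ne_zero hQ hE j) (coord_ne_zero hQ hE k) (congrArg Subtype.val h)

end Coord

variable (fQ fE) in
/-- The dehomogenization `p (x₀ / xᵢ, x₁ / xᵢ, x₂ / xᵢ)`, as a rational function on `Y`. -/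
noncomputable def evalChart (i : Fin 3) : MvPolynomial (Fin 3) F →ₐ[F] functionField fQ fE :=
  aeval fun j => ratio fQ fE j.castSucc i.castSucc

theorem evalChart_X (i j : Fin 3) :
    evalChart fQ fE i (X j) = ratio fQ fE j.castSucc i.castSucc :=
  aeval_X _ _

theorem range_evalChart (i : Fin 3) : (evalChart fQ fE i).range = chartE fQ fE i := by
  rw [chartE, Algebra.adjoin_range_eq_range_aeval, evalChart]

theorem evalChart_mem (i : Fin 3) (p : MvPolynomial (Fin 3) F) :
    evalChart fQ fE i p ∈ chartE fQ fE i := by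
  rw [← range_evalChart]
  exact ⟨p, rfl⟩

theorem coe_evalChart {p : MvPolynomial (Fin 3) F} {n : ℕ} (hp : p.IsHomogeneous n) (i : Fin 3) :
    (evalChart fQ fE i p : ConeField fQ fE) =
      (coord fQ fE i.castSucc)⁻¹ ^ n * evalCone fQ fE p := by
  rw [evalCone, ← aeval_mul_of_isHomogeneous hp]
  have h : ((functionField fQ fE).val.comp (evalChart fQ fE i)) =
      aeval fun j : Fin 3 => (coord fQ fE i.castSucc)⁻¹ * coord fQ fE j.castSucc := by
    ext j
    simp [evalChart, ratio, div_eq_inv_mul]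
  exact DFunLike.congr_fun h p

theorem evalChart_eq_zero_of_dvd (hE : fE.IsHomogeneous 3) (i : Fin 3) :
    evalChart fQ fE i fE = 0 := by
  refine Subtype.ext ?_
  rw [coe_evalChart hE, evalCone_eq_zero.mpr dvd_rfl, mul_zero]
  rfl

theorem ratio_last_sq (hQ : fQ.IsHomogeneous 2) (i : Fin 3) :
    ratio fQ fE 3 i.castSucc ^ 2 = -evalChart fQ fE i fQ := by
  refine Subtype.ext ?_
  rw [NegMemClass.coe_neg, coe_evalChart hQ, ← mul_neg, ← coord_last_sq]
  simp [ratio, div_eq_inv_mul, mul_pow]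

theorem evalChart_change (hQ : fQ.IsHomogeneous 2) (hE : fE.IsHomogeneous 3)
    {p : MvPolynomial (Fin 3) F} {n : ℕ} (hp : p.IsHomogeneous n) (i k : Fin 3) :
    evalChart fQ fE i p = ratio fQ fE k.castSucc i.castSucc ^ n * evalChart fQ fE k p := by
  rw [evalChart, evalChart, ← aeval_mul_of_isHomogeneous hp]
  simp_rw [mul_comm (ratio fQ fE k.castSucc i.castSucc), ratio_mul_ratio hQ hE]

/-! ### The involution and the charts -/

theorem coe_involution (x : functionField fQ fE) :
    (involution fQ fE x : ConeField fQ fE) = involutionCone fQ fE x := rfl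

theorem involution_ratio (j k : Fin 3) :
    involution fQ fE (ratio fQ fE j.castSucc k.castSucc) =
      ratio fQ fE j.castSucc k.castSucc := by
  refine Subtype.ext ?_
  have h3 : ∀ l : Fin 3, l.castSucc ≠ (3 : Fin 4) := fun l => Fin.castSucc_ne_last l
  simp [coe_involution, ratio, involutionCone_coord, h3]

theorem involution_ratio_last (k : Fin 3) :
    involution fQ fE (ratio fQ fE 3 k.castSucc) = -ratio fQ fE 3 k.castSucc := by
  refine Subtype.ext ?_
  have h3 : k.castSucc ≠ (3 : Fin 4) := Fin.castSucc_ne_last k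
  simp [coe_involution, ratio, involutionCone_coord, h3, neg_div]

theorem involution_ratio_last' (k : Fin 3) :
    involution fQ fE (ratio fQ fE k.castSucc 3) = -ratio fQ fE k.castSucc 3 := by
  refine Subtype.ext ?_
  have h3 : k.castSucc ≠ (3 : Fin 4) := Fin.castSucc_ne_last k
  simp [coe_involution, ratio, involutionCone_coord, h3, div_neg]

theorem involution_of_mem_chartE {i : Fin 3} {x : functionField fQ fE}
    (hx : x ∈ chartE fQ fE i) : involution fQ fE x = x := by
  rw [← range_evalChart] at hx
  obtain ⟨p, rfl⟩ := hx
  have h : (involution fQ fE).comp (evalChart fQ fE i) = evalChart fQ fE i := by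
    ext j : 1
    rw [AlgHom.comp_apply, evalChart_X, involution_ratio]
  exact DFunLike.congr_fun h p

/-- On the charts, `O_Y = O_E ⊕ O_E · s` with `s = x₃ / xᵢ`. -/
theorem mem_chartY_iff (hQ : fQ.IsHomogeneous 2) (i : Fin 3) {x : functionField fQ fE} :
    x ∈ chartY fQ fE i ↔ ∃ a ∈ chartE fQ fE i, ∃ b ∈ chartE fQ fE i,
      x = a + b * ratio fQ fE 3 i.castSucc := by
  constructor
  · intro hx
    induction hx using Algebra.adjoin_induction with
    | mem x hx =>
      obtain ⟨j, rfl⟩ := hx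
      induction j using Fin.lastCases with
      | last => exact ⟨0, zero_mem _, 1, one_mem _, by simp⟩
      | cast j => exact ⟨_, ratio_mem_chartE fQ fE j i, 0, zero_mem _, by simp⟩
    | algebraMap r => exact ⟨algebraMap F _ r, algebraMap_mem _ r, 0, zero_mem _, by simp⟩
    | add x y _ _ hx hy =>
      obtain ⟨a, ha, b, hb, rfl⟩ := hx
      obtain ⟨a', ha', b', hb', rfl⟩ := hy
      exact ⟨a + a', add_mem ha ha', b + b', add_mem hb hb', by ring⟩
    | mul x y _ _ hx hy =>
      obtain ⟨a, ha, b, hb, rfl⟩ := hx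
      obtain ⟨a', ha', b', hb', rfl⟩ := hy
      refine ⟨a * a' + b * b' * -evalChart fQ fE i fQ, ?_, a * b' + b * a', ?_, ?_⟩
      · exact add_mem (mul_mem ha ha') (mul_mem (mul_mem hb hb') (neg_mem (evalChart_mem i fQ)))
      · exact add_mem (mul_mem ha hb') (mul_mem hb ha')
      · rw [← ratio_last_sq hQ]
        ring
  · rintro ⟨a, ha, b, hb, rfl⟩
    exact add_mem (chartE_le_chartY fQ fE i ha)
      (mul_mem (chartE_le_chartY fQ fE i hb) (ratio_mem_chartY fQ fE 3 i))

theorem exists_form_of_mem_chartE (hQ : fQ.IsHomogeneous 2) (hE : fE.IsHomogeneous 3) {i : Fin 3}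
    {x : functionField fQ fE} (hx : x ∈ chartE fQ fE i) :
    ∃ N, ∃ p : MvPolynomial (Fin 3) F, p.IsHomogeneous N ∧
      (x : ConeField fQ fE) * coord fQ fE i.castSucc ^ N = evalCone fQ fE p := by
  have h0 := coord_ne_zero hQ hE i.castSucc
  induction hx using Algebra.adjoin_induction with
  | mem x hx =>
    obtain ⟨j, rfl⟩ := hx
    refine ⟨1, X j, isHomogeneous_X F j, ?_⟩
    rw [evalCone_X, pow_one]
    exact div_mul_cancel₀ _ h0
  | algebraMap r =>
    refine ⟨0, C r, isHomogeneous_C _ r, ?_⟩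
    rw [pow_zero, mul_one, evalCone, aeval_C]
    rfl
  | add x y _ _ hx hy =>
    obtain ⟨N, p, hp, hx⟩ := hx
    obtain ⟨M, q, hq, hy⟩ := hy
    refine ⟨N + M, p * X i ^ M + X i ^ N * q, ?_, ?_⟩
    · exact (hp.mul (by simpa using (isHomogeneous_X F i).pow M)).add
        (IsHomogeneous.mul (by simpa using (isHomogeneous_X F i).pow N) hq)
    · rw [map_add, map_mul, map_mul, map_pow, map_pow, evalCone_X, ← hx, ← hy]
      push_cast
      ring
  | mul x y _ _ hx hy =>
    obtain ⟨N, p, hp, hx⟩ := hx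
    obtain ⟨M, q, hq, hy⟩ := hy
    refine ⟨N + M, p * q, hp.mul hq, ?_⟩
    rw [map_mul, ← hx, ← hy]
    push_cast
    ring

/-- Sections of `𝒪_E(n)` are forms of degree `n` in `x₀, x₁, x₂`. -/
theorem exists_form_of_forall_chart (hQ : fQ.IsHomogeneous 2) (hE : fE.IsHomogeneous 3)
    (hE0 : fE ≠ 0) {n : ℕ} {a : ConeField fQ fE} (h : ∀ i : Fin 3, ∃ x ∈ chartE fQ fE i,
      a = (x : ConeField fQ fE) * coord fQ fE i.castSucc ^ n) :
    ∃ q : MvPolynomial (Fin 3) F, q.IsHomogeneous n ∧ a = evalCone fQ fE q := by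
  have h1 : ∀ i : Fin 3, ∃ N, ∃ p : MvPolynomial (Fin 3) F, p.IsHomogeneous (N + n) ∧
      a * coord fQ fE i.castSucc ^ N = evalCone fQ fE p := fun i => by
    obtain ⟨x, hx, rfl⟩ := h i
    obtain ⟨N, p, hp, hxp⟩ := exists_form_of_mem_chartE hQ hE hx
    refine ⟨N, p * X i ^ n, hp.mul (by simpa using (isHomogeneous_X F i).pow n), ?_⟩
    rw [map_mul, map_pow, evalCone_X, ← hxp]
    ring
  choose M p hp hap using h1
  -- A common exponent for the three charts.
  let N := ∑ i, M i
  have hN : ∀ i, M i ≤ N := fun i => Finset.single_le_sum (by simp) (Finset.mem_univ i)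
  have hap' : ∀ i, a * coord fQ fE i.castSucc ^ N = evalCone fQ fE (p i * X i ^ (N - M i)) :=
    fun i => by
      rw [map_mul, map_pow, evalCone_X, ← hap, mul_assoc, ← pow_add, Nat.add_sub_cancel' (hN i)]
  obtain ⟨q, hq, hpq⟩ := exists_form_of_local hE hE0 (n := n) (N := N)
    (p := fun i => p i * X i ^ (N - M i))
    (fun i => by
      have := (hp i).mul ((isHomogeneous_X F i).pow (N - M i))
      convert this using 1
      have := hN i
      omega)
    (fun i j => by
      rw [← evalCone_eq_zero (fQ := fQ), map_sub, map_mul _ (_ * _) (X j ^ N),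
        map_mul _ (_ * _) (X i ^ N), ← hap', ← hap', map_pow, map_pow, evalCone_X, evalCone_X]
      ring)
  refine ⟨q, hq, ?_⟩
  have h0 := hpq 0
  rw [← evalCone_eq_zero (fQ := fQ), map_sub, ← hap', map_mul, map_pow, evalCone_X, mul_comm a,
    ← mul_sub, mul_eq_zero] at h0
  exact sub_eq_zero.mp (h0.resolve_left (pow_ne_zero _ (coord_ne_zero hQ hE _)))

/-- Nullstellensatz on a chart of `E`, for two polynomials. -/
theorem exists_bezout_of_no_common_zero (hQ : fQ.IsHomogeneous 2) (hE : fE.IsHomogeneous 3)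
    (i : Fin 3) (p q : MvPolynomial (Fin 3) F)
    (hpq : ∀ v : Fin 3 → AlgebraicClosure F, v i = 1 → aeval v fE = 0 → aeval v p = 0 →
      aeval v q ≠ 0) :
    ∃ a ∈ chartE fQ fE i, ∃ b ∈ chartE fQ fE i,
      a * evalChart fQ fE i p + b * evalChart fQ fE i q = 1 := by
  let t : Fin 3 → chartE fQ fE i := fun l => ⟨_, ratio_mem_chartE fQ fE l i⟩
  have ht : Algebra.adjoin F (Set.range t) = ⊤ := by
    refine (Subalgebra.map_injective (f := (chartE fQ fE i).val) Subtype.val_injective) ?_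
    rw [AlgHom.map_adjoin, ← Set.range_comp, Algebra.map_top, Subalgebra.range_val]
    rfl
  have hcoe : ∀ p, (aeval t p : chartE fQ fE i) = evalChart fQ fE i p := fun p => by
    have h : (chartE fQ fE i).val.comp (aeval t) = evalChart fQ fE i := by
      ext l : 1
      simp [t, evalChart_X]
    exact DFunLike.congr_fun h p
  have hI : Ideal.span {aeval t p, aeval t q} = ⊤ := by
    by_contra hI
    obtain ⟨v, hv⟩ := exists_geometric_zero ht hI
    have hv0 : ∀ r, evalChart fQ fE i r = 0 → aeval v r = 0 := fun r hr => hv r (by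
      rw [show aeval t r = (0 : chartE fQ fE i) from Subtype.ext ((hcoe r).trans hr)]
      exact zero_mem _)
    have hvi := hv0 (X i - 1) (by
      rw [map_sub, evalChart_X, ratio_self hQ hE, map_one, sub_self])
    rw [map_sub, aeval_X, map_one, sub_eq_zero] at hvi
    exact hpq v hvi (hv0 fE (evalChart_eq_zero_of_dvd hE i))
      (hv _ (Ideal.subset_span (Set.mem_insert _ _)))
      (hv _ (Ideal.subset_span (Set.mem_insert_of_mem _ rfl)))
  obtain ⟨a, b, hab⟩ := Ideal.mem_span_pair.mp ((Ideal.eq_top_iff_one _).mp hI)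
  refine ⟨a, a.2, b, b.2, ?_⟩
  rw [← hcoe, ← hcoe]
  exact congrArg Subtype.val hab

theorem sum_fin_three_rotate {M : Type*} [AddCommMonoid M] (f : Fin 3 → M) (i : Fin 3) :
    ∑ j, f j = f i + f (i + 1) + f (i + 2) := by
  rw [Fin.sum_univ_three]
  match i with
  | 0 => rfl
  | 1 => exact add_rotate _ _ _
  | 2 => exact (add_rotate _ _ _).symm

theorem eq_or_eq_add_fin_three (i l : Fin 3) : l = i ∨ l = i + 1 ∨ l = i + 2 := by
  revert i l
  decide

/-- At a geometric point of `E` with `xᵢ ≠ 0`, one of the partial derivatives in the two affine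
coordinates does not vanish, by Euler's identity. -/
theorem pderiv_ne_zero_of_isSmoothPlaneCurve (hE : fE.IsHomogeneous 3)
    (hsm : IsSmoothPlaneCurve fE) {i : Fin 3} {v : Fin 3 → AlgebraicClosure F} (hvi : v i = 1)
    (hv : aeval v fE = 0) (h1 : aeval v (pderiv (i + 1) fE) = 0) :
    aeval v (pderiv (i + 2) fE) ≠ 0 := fun h2 => by
  have heu := euler_aeval hE hv
  rw [sum_fin_three_rotate _ i, h1, h2, hvi, mul_zero, mul_zero, add_zero, add_zero,
    one_mul] at heu
  obtain ⟨l, hne⟩ := hsm v (fun h => one_ne_zero (hvi.symm.trans (congrFun h i))) hv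
  rcases eq_or_eq_add_fin_three i l with rfl | rfl | rfl
  exacts [hne heu, hne h1, hne h2]

/-- Smoothness of `E` on the chart `xᵢ ≠ 0`: the partial derivatives in the two affine coordinates
generate the unit ideal. -/
theorem exists_bezout_pderiv (hE : fE.IsHomogeneous 3) (hQ : fQ.IsHomogeneous 2)
    (hsm : IsSmoothPlaneCurve fE) (i : Fin 3) :
    ∃ a ∈ chartE fQ fE i, ∃ b ∈ chartE fQ fE i,
      a * evalChart fQ fE i (pderiv (i + 1) fE) + b * evalChart fQ fE i (pderiv (i + 2) fE) = 1 :=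
  exists_bezout_of_no_common_zero hQ hE i _ _ fun _ hvi hv h1 =>
    pderiv_ne_zero_of_isSmoothPlaneCurve hE hsm hvi hv h1

end FunctionField

/-! ### The invariant differential of `E` -/

section Derivations

variable {F : Type*} [Field F]

theorem derivation_aeval {A M : Type*} [CommRing A] [Algebra F A] [AddCommGroup M] [Module A M]
    [Module F M] [IsScalarTower F A M] {n : ℕ} (D : Derivation F A M) (v : Fin n → A)
    (p : MvPolynomial (Fin n) F) :
    D (aeval v p) = ∑ j, aeval v (pderiv j p) • D (v j) := by
  induction p using MvPolynomial.induction_on with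
  | C a => simp
  | add p q hp hq => simp only [map_add, hp, hq, add_smul, Finset.sum_add_distrib]
  | mul_X p i hp =>
    have h1 : ∀ j, aeval v (pderiv j (p * X i)) • D (v j) =
        v i • (aeval v (pderiv j p) • D (v j)) +
          if j = i then aeval v p • D (v i) else 0 := fun j => by
      rw [Derivation.leibniz, pderiv_X]
      by_cases hj : j = i
      · subst hj
        simp [add_smul, smul_smul, add_comm]
      · simp [hj, smul_smul, Ne.symm hj]
    simp_rw [h1]
    rw [Finset.sum_add_distrib, ← Finset.smul_sum, ← hp, Finset.sum_ite_eq' Finset.univ i]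
    simp [add_comm]

theorem derivation_quotient {K M : Type*} [Field K] [Algebra F K] [AddCommGroup M] [Module K M]
    [Module F M] (D : Derivation F K M) {p q r t : K} (hpq : p * q = t) (hrq : r * q = 1) :
    D p = r ^ 2 • (q • D t - t • D q) := by
  subst hpq
  rw [Derivation.leibniz]
  linear_combination (norm := module) (-(r * q + 1)) • hrq • D p

theorem eq_smul_of_relation {K M : Type*} [Field K] [AddCommGroup M] [Module K M] {a b g h : K}
    {x y : M} (hxy : g • x + h • y = 0) (hab : a * g + b * h = 1) :
    x = h • (b • x - a • y) ∧ y = -g • (b • x - a • y) := by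
  constructor
  · linear_combination (norm := module) a • hxy - hab • x
  · linear_combination (norm := module) b • hxy - hab • y

theorem D_mem_kaehlerImage {K : Type*} [Field K] [Algebra F K] {A : Subalgebra F K} {x : K}
    (hx : x ∈ A) : KaehlerDifferential.D F K x ∈ kaehlerImage A :=
  ⟨KaehlerDifferential.D F A ⟨x, hx⟩, KaehlerDifferential.map_D F F A K _⟩

theorem kaehlerImage_le {K : Type*} [Field K] [Algebra F K] {A : Subalgebra F K} {s : Set K}
    (hA : A = Algebra.adjoin F s) {N : Submodule A Ω[K⁄F]}
    (h : ∀ x ∈ s, KaehlerDifferential.D F K x ∈ N) : kaehlerImage A ≤ N := by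
  have h1 : ∀ x (hx : x ∈ Algebra.adjoin F s), KaehlerDifferential.D F K x ∈ N := fun x hx => by
    induction hx using Algebra.adjoin_induction with
    | mem x hx => exact h x hx
    | algebraMap r => simp
    | add x y _ _ hx hy => rw [map_add]; exact add_mem hx hy
    | mul x y hx' hy' hx hy =>
      rw [Derivation.leibniz]
      exact add_mem (N.smul_mem ⟨x, hA ▸ hx'⟩ hy) (N.smul_mem ⟨y, hA ▸ hy'⟩ hx)
  have h2 : ∀ ω : Ω[A⁄F], KaehlerDifferential.map F F A K ω ∈ N.toAddSubmonoid := fun ω => by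
    have hω : ω ∈ Submodule.span A (Set.range (KaehlerDifferential.D F A)) := by
      rw [KaehlerDifferential.span_range_derivation]
      trivial
    induction hω using Submodule.span_induction with
    | mem ω hω =>
      obtain ⟨x, rfl⟩ := hω
      rw [KaehlerDifferential.map_D]
      exact h1 x (hA ▸ x.2)
    | zero => rw [map_zero]; exact zero_mem _
    | add ω η _ _ hω hη => rw [map_add]; exact add_mem hω hη
    | smul a ω _ hω => rw [map_smul]; exact N.smul_mem a hω
  rintro _ ⟨ω, rfl⟩
  exact h2 ω

end Derivations

section InvariantDifferential

variable {F : Type*} [Field F] {fQ fE : MvPolynomial (Fin 3) F}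

variable (fQ fE) in
/-- The vector field on the cone over `Y` that annihilates `x₀` and, up to sign, sends a function
to its Jacobian determinant with `x₀` and the two equations of `Y`. -/
noncomputable def jacobianDerivation :
    Derivation F (MvPolynomial (Fin 4) F) (MvPolynomial (Fin 4) F) :=
  mkDerivation F ![0, 2 * X 3 * cone (pderiv 2 fE), -(2 * X 3 * cone (pderiv 1 fE)),
    cone (pderiv 2 fQ) * cone (pderiv 1 fE) - cone (pderiv 1 fQ) * cone (pderiv 2 fE)]

theorem jacobianDerivation_X (j : Fin 4) : jacobianDerivation fQ fE (X j) =
    ![0, 2 * X 3 * cone (pderiv 2 fE), -(2 * X 3 * cone (pderiv 1 fE)),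
    cone (pderiv 2 fQ) * cone (pderiv 1 fE) - cone (pderiv 1 fQ) * cone (pderiv 2 fE)] j :=
  mkDerivation_X _ _ _

theorem jacobianDerivation_cone (p : MvPolynomial (Fin 3) F) :
    jacobianDerivation fQ fE (cone p) =
      2 * X 3 * (cone (pderiv 1 p) * cone (pderiv 2 fE) -
        cone (pderiv 2 p) * cone (pderiv 1 fE)) := by
  have h : ∀ q : MvPolynomial (Fin 3) F, cone q = aeval (fun j => X j.castSucc) q := fun q => by
    rw [← aeval_cone, aeval_X_left_apply]
  rw [h p, derivation_aeval, Fin.sum_univ_three, ← h, ← h, ← h, jacobianDerivation_X,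
    jacobianDerivation_X, jacobianDerivation_X]
  change _ • 0 + cone (pderiv 1 p) * (2 * X 3 * cone (pderiv 2 fE)) +
    cone (pderiv 2 p) * -(2 * X 3 * cone (pderiv 1 fE)) = _
  rw [smul_zero]
  ring

theorem jacobianDerivation_mem {p : MvPolynomial (Fin 4) F} (hp : p ∈ idealY fQ fE) :
    jacobianDerivation fQ fE p ∈ idealY fQ fE := by
  rw [idealY, Ideal.mem_span_pair] at hp
  obtain ⟨a, b, rfl⟩ := hp
  have h1 : jacobianDerivation fQ fE (cone fE) = 0 := by
    rw [jacobianDerivation_cone]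
    ring
  have h2 : jacobianDerivation fQ fE (quadric fQ) = 0 := by
    rw [quadric, map_add, jacobianDerivation_cone, Derivation.leibniz_pow, jacobianDerivation_X]
    simp
    ring
  rw [map_add, Derivation.leibniz, Derivation.leibniz, h1, h2, smul_zero, smul_zero, zero_add,
    zero_add]
  exact add_mem (Ideal.mul_mem_right _ _ (Ideal.subset_span (by simp)))
    (Ideal.mul_mem_right _ _ (Ideal.subset_span (by simp)))

variable [(idealY fQ fE).IsPrime]

/-- A shortcut for the typeclass search. -/
noncomputable instance : Module (functionField fQ fE) (RatDiff fQ fE) := inferInstance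

/-- A shortcut for the typeclass search. -/
noncomputable instance : SMul (functionField fQ fE) (RatDiff fQ fE) := inferInstance

/-- If `d (xⱼ / x₀) = 0` for `j = 1` or `2`, then the Jacobian vector field kills `xⱼ` on `Y`, as it
extends to rational functions and kills `x₀`; hence a partial derivative of `f_E` vanishes. -/
theorem evalCone_eq_zero_of_D_ratio (h2 : (2 : F) ≠ 0) (hQ : fQ.IsHomogeneous 2)
    (hE : fE.IsHomogeneous 3) {j k : Fin 3} (hjk : j = 1 ∧ k = 2 ∨ j = 2 ∧ k = 1)
    (h : KaehlerDifferential.D F (functionField fQ fE) (ratio fQ fE j.castSucc 0) = 0) :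
    evalCone fQ fE (pderiv k fE) = 0 := by
  have h0 := coord_ne_zero hQ hE 0
  let mk := Ideal.Quotient.mkₐ F (idealY fQ fE)
  let d : Derivation F (CoordRing fQ fE) (CoordRing fQ fE) :=
    Derivation.liftOfSurjective (f := mk) Ideal.Quotient.mk_surjective
      (d := jacobianDerivation fQ fE) (fun x hx => Ideal.Quotient.eq_zero_iff_mem.mpr
        (jacobianDerivation_mem (Ideal.Quotient.eq_zero_iff_mem.mp hx)))
  have hd : ∀ p, d (mk p) = mk (jacobianDerivation fQ fE p) := fun p =>
    Derivation.liftOfSurjective_apply _ _ _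
  -- Pass to the differentials of the field of fractions of the cone, where `x₀ dxⱼ = xⱼ dx₀`.
  have h1 : KaehlerDifferential.D F (ConeField fQ fE)
      (coord fQ fE j.castSucc / coord fQ fE 0) = 0 := by
    have := congrArg (pullback (functionField fQ fE).val) h
    rwa [pullback_D, map_zero] at this
  have h3 : KaehlerDifferential.map F F (CoordRing fQ fE) (ConeField fQ fE)
      (mk (X 0) • KaehlerDifferential.D F _ (mk (X j.castSucc)) -
        mk (X j.castSucc) • KaehlerDifferential.D F _ (mk (X 0))) = 0 := by
    rw [map_sub, map_smul, map_smul, KaehlerDifferential.map_D, KaehlerDifferential.map_D]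
    have hs : ∀ (r : CoordRing fQ fE) (m : Ω[ConeField fQ fE⁄F]),
        r • m = algebraMap _ (ConeField fQ fE) r • m := fun r m => (algebraMap_smul _ r m).symm
    refine Eq.trans (congrArg₂ (· - ·) (hs _ _) (hs _ _)) ?_
    change coord fQ fE 0 • KaehlerDifferential.D F _ (coord fQ fE j.castSucc) -
      coord fQ fE j.castSucc • KaehlerDifferential.D F _ (coord fQ fE 0) = 0
    conv_lhs =>
      enter [1, 2]
      rw [← div_mul_cancel₀ (coord fQ fE j.castSucc) h0, Derivation.leibniz, h1, smul_zero,
        add_zero]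
    rw [smul_smul, mul_div_cancel₀ _ h0, sub_self]
  obtain ⟨c, hc⟩ := (IsLocalizedModule.eq_zero_iff (nonZeroDivisors (CoordRing fQ fE))
    (KaehlerDifferential.map F F (CoordRing fQ fE) (ConeField fQ fE))).mp h3
  have h4 := congrArg d.liftKaehlerDifferential hc
  rw [map_zero, Submonoid.smul_def, map_smul, map_sub, map_smul, map_smul,
    Derivation.liftKaehlerDifferential_comp_D, Derivation.liftKaehlerDifferential_comp_D,
    hd, hd, jacobianDerivation_X, jacobianDerivation_X] at h4
  have h5 := congrArg (algebraMap (CoordRing fQ fE) (ConeField fQ fE)) h4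
  have hc0 : algebraMap (CoordRing fQ fE) (ConeField fQ fE) c ≠ 0 :=
    IsLocalization.to_map_ne_zero_of_mem_nonZeroDivisors _ le_rfl c.2
  have h6 : ∀ p, algebraMap (CoordRing fQ fE) (ConeField fQ fE) (mk p) =
    aeval (coord fQ fE) p := fun p => (aeval_coord p).symm
  have h7 : (2 : ConeField fQ fE) ≠ 0 := by
    have := (map_ne_zero (algebraMap F (ConeField fQ fE))).mpr h2
    rwa [map_ofNat] at this
  have h8 := coord_ne_zero hQ hE 3
  have h9 : aeval (coord fQ fE) (cone (pderiv k fE)) = evalCone fQ fE (pderiv k fE) :=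
    aeval_cone _ _
  rw [← h9]
  rcases hjk with ⟨rfl, rfl⟩ | ⟨rfl, rfl⟩ <;> simpa [h6, hc0, h0, h7, h8] using h5

/-- The pull-back to `Y` of the differential on `E` that is regular and without zeros, in the
normalization given by the equation of `E`: on the chart `xᵢ ≠ 0` with coordinates
`u = xᵢ₊₁ / xᵢ`, `v = xᵢ₊₂ / xᵢ` (indices modulo 3) it is `du / f_v = -dv / f_u`. -/
structure IsInvariantDifferential (η : RatDiff fQ fE) : Prop where
  ne_zero : η ≠ 0
  D_ratio_add_one (i : Fin 3) :
    KaehlerDifferential.D F _ (ratio fQ fE (i + 1).castSucc i.castSucc) =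
      evalChart fQ fE i (pderiv (i + 2) fE) • η
  D_ratio_add_two (i : Fin 3) :
    KaehlerDifferential.D F _ (ratio fQ fE (i + 2).castSucc i.castSucc) =
      -evalChart fQ fE i (pderiv (i + 1) fE) • η

theorem D_evalChart_eq_sum (hQ : fQ.IsHomogeneous 2) (hE : fE.IsHomogeneous 3) (i : Fin 3)
    (p : MvPolynomial (Fin 3) F) :
    KaehlerDifferential.D F (functionField fQ fE) (evalChart fQ fE i p) =
      evalChart fQ fE i (pderiv (i + 1) p) •
        KaehlerDifferential.D F _ (ratio fQ fE (i + 1).castSucc i.castSucc) +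
      evalChart fQ fE i (pderiv (i + 2) p) •
        KaehlerDifferential.D F _ (ratio fQ fE (i + 2).castSucc i.castSucc) := by
  have h0 : KaehlerDifferential.D F (functionField fQ fE)
      (ratio fQ fE i.castSucc i.castSucc) = 0 := by
    rw [ratio_self hQ hE, Derivation.map_one_eq_zero]
  rw [evalChart, derivation_aeval]
  match i with
  | 0 =>
    rw [Fin.sum_univ_three, h0, smul_zero, zero_add]
    rfl
  | 1 =>
    rw [Fin.sum_univ_three, h0, smul_zero, add_zero, add_comm]
    rfl
  | 2 =>
    rw [Fin.sum_univ_three, h0, smul_zero, add_zero]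
    rfl

theorem D_ratio_eq (hQ : fQ.IsHomogeneous 2) (hE : fE.IsHomogeneous 3) (j i k : Fin 4) :
    KaehlerDifferential.D F (functionField fQ fE) (ratio fQ fE j i) =
      (ratio fQ fE k i) ^ 2 • (ratio fQ fE i k • KaehlerDifferential.D F _ (ratio fQ fE j k) -
        ratio fQ fE j k • KaehlerDifferential.D F _ (ratio fQ fE i k)) := by
  exact derivation_quotient _ (ratio_mul_ratio hQ hE j i k)
    (by rw [ratio_mul_ratio hQ hE, ratio_self hQ hE])

theorem D_ratio_eq_smul (hQ : fQ.IsHomogeneous 2) (hE : fE.IsHomogeneous 3) {j i k : Fin 4}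
    {a b : functionField fQ fE} {η : RatDiff fQ fE}
    (hj : KaehlerDifferential.D F _ (ratio fQ fE j k) = a • η)
    (hi : KaehlerDifferential.D F _ (ratio fQ fE i k) = b • η) :
    KaehlerDifferential.D F _ (ratio fQ fE j i) =
      (ratio fQ fE k i ^ 2 * (ratio fQ fE i k * a - ratio fQ fE j k * b)) • η := by
  rw [D_ratio_eq hQ hE j i k, hi, hj, smul_smul, smul_smul, ← sub_smul, smul_smul]

theorem exists_differential_chart_zero (h2 : (2 : F) ≠ 0) (hQ : fQ.IsHomogeneous 2)
    (hE : fE.IsHomogeneous 3) (hsm : IsSmoothPlaneCurve fE) :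
    ∃ η : RatDiff fQ fE, η ≠ 0 ∧
      KaehlerDifferential.D F _ (ratio fQ fE 1 0) = evalChart fQ fE 0 (pderiv 2 fE) • η ∧
      KaehlerDifferential.D F _ (ratio fQ fE 2 0) = -evalChart fQ fE 0 (pderiv 1 fE) • η := by
  obtain ⟨a, -, b, -, hab⟩ := exists_bezout_pderiv (fQ := fQ) hE hQ hsm 0
  change a * evalChart fQ fE 0 (pderiv 1 fE) + b * evalChart fQ fE 0 (pderiv 2 fE) = 1 at hab
  have hrel : evalChart fQ fE 0 (pderiv 1 fE) • KaehlerDifferential.D F _ (ratio fQ fE 1 0) +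
      evalChart fQ fE 0 (pderiv 2 fE) • KaehlerDifferential.D F _ (ratio fQ fE 2 0) = 0 := by
    have h := D_evalChart_eq_sum hQ hE 0 fE
    rw [evalChart_eq_zero_of_dvd hE, map_zero] at h
    exact h.symm
  obtain ⟨hDu, hDv⟩ := eq_smul_of_relation hrel hab
  refine ⟨_, ?_, hDu, hDv⟩
  intro h0
  rw [h0, smul_zero] at hDu hDv
  have hdeg : ∀ k, (pderiv k fE).IsHomogeneous 2 := fun k => hE.pderiv
  have e2 := evalCone_eq_zero_of_D_ratio h2 hQ hE (j := 1) (k := 2) (by simp) hDu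
  have e1 := evalCone_eq_zero_of_D_ratio h2 hQ hE (j := 2) (k := 1) (by simp) hDv
  have e : ∀ k, evalCone fQ fE (pderiv k fE) = 0 → evalChart fQ fE 0 (pderiv k fE) = 0 :=
    fun k hk => Subtype.ext (by rw [coe_evalChart (hdeg k), hk, mul_zero]; rfl)
  rw [e 1 e1, e 2 e2, mul_zero, mul_zero, add_zero] at hab
  exact zero_ne_one hab

theorem exists_isInvariantDifferential (h2 : (2 : F) ≠ 0) (hQ : fQ.IsHomogeneous 2)
    (hE : fE.IsHomogeneous 3) (hsm : IsSmoothPlaneCurve fE) :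
    ∃ η : RatDiff fQ fE, IsInvariantDifferential η := by
  obtain ⟨η, hη, hu, hv⟩ := exists_differential_chart_zero (fQ := fQ) h2 hQ hE hsm
  have hw : KaehlerDifferential.D F _ (ratio fQ fE 0 0) = (0 : functionField fQ fE) • η := by
    rw [ratio_self hQ hE, Derivation.map_one_eq_zero, zero_smul]
  have heu : evalChart fQ fE 0 (pderiv 0 fE) +
      ratio fQ fE 1 0 * evalChart fQ fE 0 (pderiv 1 fE) +
      ratio fQ fE 2 0 * evalChart fQ fE 0 (pderiv 2 fE) = 0 := by
    have h := euler_aeval hE (evalChart_eq_zero_of_dvd (fQ := fQ) hE 0)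
    rw [Fin.sum_univ_three] at h
    have h1 : ratio fQ fE (0 : Fin 3).castSucc (0 : Fin 3).castSucc = 1 := ratio_self hQ hE _
    rw [h1, one_mul] at h
    exact h
  have h00 := ratio_self (fQ := fQ) (fE := fE) hQ hE 0
  have hch : ∀ i k, evalChart fQ fE i (pderiv k fE) =
      ratio fQ fE 0 i.castSucc ^ 2 * evalChart fQ fE 0 (pderiv k fE) :=
    fun i k => evalChart_change hQ hE (hE.pderiv) i 0
  refine ⟨η, hη, fun i => ?_, fun i => ?_⟩
  · match i with
    | 0 => exact hu
    | 1 =>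
      refine (D_ratio_eq_smul hQ hE hv hu).trans (congrArg (· • η) ?_)
      refine Eq.trans ?_ (hch 1 0).symm
      change ratio fQ fE 0 1 ^ 2 * _ = ratio fQ fE 0 1 ^ 2 * _
      linear_combination (-ratio fQ fE 0 1 ^ 2) * heu
    | 2 =>
      refine (D_ratio_eq_smul hQ hE hw hv).trans (congrArg (· • η) ?_)
      refine Eq.trans ?_ (hch 2 1).symm
      change ratio fQ fE 0 2 ^ 2 * _ = ratio fQ fE 0 2 ^ 2 * _
      rw [h00]
      ring
  · match i with
    | 0 => exact hv
    | 1 =>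
      refine (D_ratio_eq_smul hQ hE hw hu).trans (congrArg (· • η) ?_)
      refine Eq.trans ?_ (congrArg Neg.neg (hch 1 2)).symm
      change ratio fQ fE 0 1 ^ 2 * _ = -(ratio fQ fE 0 1 ^ 2 * _)
      rw [h00]
      ring
    | 2 =>
      refine (D_ratio_eq_smul hQ hE hu hv).trans (congrArg (· • η) ?_)
      refine Eq.trans ?_ (congrArg Neg.neg (hch 2 0)).symm
      change ratio fQ fE 0 2 ^ 2 * _ = -(ratio fQ fE 0 2 ^ 2 * _)
      linear_combination (ratio fQ fE 0 2 ^ 2) * heu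

end InvariantDifferential

/-! ### The ramification in the smooth case -/

section Smooth

variable {F : Type*} [Field F] {fQ fE : MvPolynomial (Fin 3) F}

theorem pderiv_castSucc_cone (j : Fin 3) (p : MvPolynomial (Fin 3) F) :
    pderiv j.castSucc (cone p) = cone (pderiv j p) :=
  pderiv_rename (Fin.castSucc_injective 3) j p

theorem pderiv_last_cone (p : MvPolynomial (Fin 3) F) : pderiv 3 (cone p) = 0 := by
  classical
  refine pderiv_eq_zero_of_notMem_vars fun h => ?_
  obtain ⟨j, -, hj⟩ := Finset.mem_image.mp (vars_rename _ _ h)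
  exact Fin.castSucc_ne_last j hj

/-- If `Y` is smooth, then `f_Q` has only simple zeros on `E`. -/
theorem jacobian_ne_zero_of_isSmoothY (hQ : fQ.IsHomogeneous 2)
    (hE : fE.IsHomogeneous 3) (hsm : IsSmoothPlaneCurve fE) (hY : IsSmoothY fQ fE) {i : Fin 3}
    {v : Fin 3 → AlgebraicClosure F} (hvi : v i = 1) (hvE : aeval v fE = 0)
    (hvQ : aeval v fQ = 0) :
    aeval v (pderiv (i + 1) fQ * pderiv (i + 2) fE - pderiv (i + 2) fQ * pderiv (i + 1) fE) ≠
      0 := by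
  intro hm
  let w : Fin 4 → AlgebraicClosure F := Fin.lastCases (motive := fun _ => AlgebraicClosure F) 0 v
  have hw3 : w 3 = 0 := Fin.lastCases_last ..
  have hwv : (fun j : Fin 3 => w j.castSucc) = v := funext fun j => Fin.lastCases_castSucc ..
  have hcone : ∀ p : MvPolynomial (Fin 3) F, aeval w (cone p) = aeval v p := fun p => by
    rw [aeval_cone, hwv]
  have hw0 : w ≠ 0 := fun h => by
    have h1 := congrFun hwv i
    rw [hvi] at h1
    exact one_ne_zero (h1.symm.trans (congrFun h _))
  have hli := hY w hw0 (by rw [quadric, map_add, hcone, hvQ, map_pow, aeval_X, hw3]; simp)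
    (by rw [hcone, hvE])
  rw [LinearIndependent.pair_iff] at hli
  have heE := euler_aeval hE hvE
  have heQ := euler_aeval hQ hvQ
  rw [sum_fin_three_rotate _ i, hvi, one_mul] at heE heQ
  rw [map_sub, map_mul, map_mul] at hm
  -- Euler's identities express the other minors of the Jacobian matrix by the given one.
  have hminor : ∀ k, k = i + 1 ∨ k = i + 2 → ∀ j, aeval v (pderiv k fE) * aeval v (pderiv j fQ) +
      -aeval v (pderiv k fQ) * aeval v (pderiv j fE) = 0 := by
    intro k hk j
    rcases eq_or_eq_add_fin_three i j with rfl | rfl | rfl <;> rcases hk with rfl | rfl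
    · linear_combination aeval v (pderiv (j + 1) fE) * heQ - aeval v (pderiv (j + 1) fQ) * heE
        + v (j + 2) * hm
    · linear_combination aeval v (pderiv (j + 2) fE) * heQ - aeval v (pderiv (j + 2) fQ) * heE
        - v (j + 1) * hm
    · ring
    · linear_combination hm
    · linear_combination -hm
    · ring
  have hzero : ∀ k, k = i + 1 ∨ k = i + 2 → aeval v (pderiv k fE) = 0 := fun k hk => by
    refine (hli (aeval v (pderiv k fE)) (-aeval v (pderiv k fQ)) ?_).1
    ext j
    induction j using Fin.lastCases with
    | last =>
      have h3 : Fin.last 3 = 3 := rfl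
      simp [h3, quadric, pderiv_last_cone, Derivation.leibniz_pow, hw3]
    | cast j =>
      have h3 : (3 : Fin 4) ≠ j.castSucc := (Fin.castSucc_ne_last j).symm
      have h4 : pderiv j.castSucc (X 3 ^ 2 : MvPolynomial (Fin 4) F) = 0 := by
        rw [Derivation.leibniz_pow, pderiv_X_of_ne h3, smul_zero, smul_zero]
      simp only [Pi.add_apply, Pi.smul_apply, smul_eq_mul, Pi.zero_apply, quadric, map_add, h4,
        map_zero, add_zero, pderiv_castSucc_cone, hcone]
      exact hminor k hk j
  exact pderiv_ne_zero_of_isSmoothPlaneCurve hE hsm hvi hvE (hzero _ (Or.inl rfl))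
    (hzero _ (Or.inr rfl))

end Smooth

/-! ### The dualizing sheaf on the charts -/

section Canonical

variable {F : Type*} [Field F] {fQ fE : MvPolynomial (Fin 3) F} [(idealY fQ fE).IsPrime]

theorem two_ne_zero_functionField (h2 : (2 : F) ≠ 0) : (2 : functionField fQ fE) ≠ 0 := by
  have := (map_ne_zero (algebraMap F (functionField fQ fE))).mpr h2
  rwa [map_ofNat] at this

variable {η : RatDiff fQ fE}

theorem IsInvariantDifferential.D_evalChart (hη : IsInvariantDifferential η)
    (hQ : fQ.IsHomogeneous 2) (hE : fE.IsHomogeneous 3) (i : Fin 3) (p : MvPolynomial (Fin 3) F) :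
    KaehlerDifferential.D F _ (evalChart fQ fE i p) =
      evalChart fQ fE i (pderiv (i + 1) p * pderiv (i + 2) fE -
        pderiv (i + 2) p * pderiv (i + 1) fE) • η := by
  rw [D_evalChart_eq_sum hQ hE, hη.D_ratio_add_one, hη.D_ratio_add_two, smul_smul, smul_smul,
    ← add_smul, map_sub, map_mul, map_mul, mul_neg, sub_eq_add_neg]

theorem IsInvariantDifferential.two_smul_D_ratio_last (hη : IsInvariantDifferential η)
    (hQ : fQ.IsHomogeneous 2) (hE : fE.IsHomogeneous 3) (i : Fin 3) :
    (2 * ratio fQ fE 3 i.castSucc) • KaehlerDifferential.D F _ (ratio fQ fE 3 i.castSucc) =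
      -evalChart fQ fE i (pderiv (i + 1) fQ * pderiv (i + 2) fE -
        pderiv (i + 2) fQ * pderiv (i + 1) fE) • η := by
  have h := congrArg (KaehlerDifferential.D F (functionField fQ fE)) (ratio_last_sq (fE := fE) hQ i)
  rw [map_neg, hη.D_evalChart hQ hE, ← neg_smul] at h
  rw [← h, sq, Derivation.leibniz, ← add_smul, two_mul]

theorem IsInvariantDifferential.exists_eq_smul (hη : IsInvariantDifferential η)
    (h2 : (2 : F) ≠ 0) (hQ : fQ.IsHomogeneous 2) (hE : fE.IsHomogeneous 3) (ω : RatDiff fQ fE) :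
    ∃ g : functionField fQ fE, ω = g • η := by
  let D := KaehlerDifferential.D F (functionField fQ fE)
  let W : Submodule (functionField fQ fE) (RatDiff fQ fE) := Submodule.span _ {η}
  have hlast : D (ratio fQ fE 3 0) ∈ W := by
    have h := hη.two_smul_D_ratio_last hQ hE 0
    have hne : 2 * ratio fQ fE 3 0 ≠ 0 :=
      mul_ne_zero (two_ne_zero_functionField h2) (ratio_ne_zero hQ hE 3 0)
    refine (Submodule.smul_mem_iff W hne).mp ?_
    exact Submodule.mem_span_singleton.mpr ⟨_, h.symm⟩
  have hzero : ∀ j, D (ratio fQ fE j 0) ∈ W := fun j => by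
    induction j using Fin.lastCases with
    | last => exact hlast
    | cast j =>
      refine Submodule.mem_span_singleton.mpr ⟨_, ((hη.D_evalChart hQ hE 0 (X j)).symm.trans ?_)⟩
      rw [evalChart_X]
      rfl
  have hall : ∀ x (hx : x ∈ functionField fQ fE), D ⟨x, hx⟩ ∈ W := by
    intro x hx
    induction hx using IntermediateField.adjoin_induction with
    | mem x hx =>
      obtain ⟨⟨j, k⟩, rfl⟩ := hx
      have h := D_ratio_eq (fQ := fQ) hQ hE j k 0
      change D (ratio fQ fE j k) ∈ W
      rw [show D (ratio fQ fE j k) = _ from h]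
      exact W.smul_mem _ (sub_mem (W.smul_mem _ (hzero j)) (W.smul_mem _ (hzero k)))
    | algebraMap r =>
      rw [show D ⟨algebraMap F _ r, _⟩ = 0 from D.map_algebraMap r]
      exact zero_mem _
    | add x y hx' hy' hx hy =>
      rw [show D ⟨x + y, _⟩ = _ from D.map_add ⟨x, hx'⟩ ⟨y, hy'⟩]
      exact add_mem hx hy
    | mul x y hx' hy' hx hy =>
      rw [show D ⟨x * y, _⟩ = _ from D.leibniz ⟨x, hx'⟩ ⟨y, hy'⟩]
      exact add_mem (W.smul_mem _ hy) (W.smul_mem _ hx)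
    | inv x hx' hx =>
      rw [show D ⟨x⁻¹, _⟩ = _ from D.leibniz_inv ⟨x, hx'⟩]
      exact W.smul_mem _ hx
  have htop : Submodule.span (functionField fQ fE) (Set.range D) ≤ W :=
    Submodule.span_le.mpr (by rintro _ ⟨x, rfl⟩; exact hall x x.2)
  rw [KaehlerDifferential.span_range_derivation] at htop
  obtain ⟨g, hg⟩ := Submodule.mem_span_singleton.mp (htop (Submodule.mem_top (x := ω)))
  exact ⟨g, hg.symm⟩

theorem IsInvariantDifferential.exists_eq_combination (hη : IsInvariantDifferential η)
    (hQ : fQ.IsHomogeneous 2) (hE : fE.IsHomogeneous 3) (hsm : IsSmoothPlaneCurve fE)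
    (i : Fin 3) : ∃ a ∈ chartE fQ fE i, ∃ b ∈ chartE fQ fE i,
      η = a • KaehlerDifferential.D F _ (ratio fQ fE (i + 1).castSucc i.castSucc) +
        b • KaehlerDifferential.D F _ (ratio fQ fE (i + 2).castSucc i.castSucc) := by
  obtain ⟨a, ha, b, hb, hab⟩ := exists_bezout_pderiv (fQ := fQ) hE hQ hsm i
  refine ⟨b, hb, -a, neg_mem ha, ?_⟩
  rw [hη.D_ratio_add_one, hη.D_ratio_add_two, smul_smul, smul_smul, ← add_smul, neg_mul_neg,
    add_comm, hab, one_smul]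

/-- The differential `η` generates the sheaf of differentials of `E`. -/
theorem IsInvariantDifferential.mem_kaehlerImage_chartE (hη : IsInvariantDifferential η)
    (hQ : fQ.IsHomogeneous 2) (hE : fE.IsHomogeneous 3) (hsm : IsSmoothPlaneCurve fE)
    (i : Fin 3) (g : functionField fQ fE) :
    g • η ∈ kaehlerImage (chartE fQ fE i) ↔ g ∈ chartE fQ fE i := by
  have hself : η ∈ kaehlerImage (chartE fQ fE i) := by
    obtain ⟨a, ha, b, hb, h⟩ := hη.exists_eq_combination hQ hE hsm i
    rw [h]
    exact add_mem
      (Submodule.smul_mem _ (⟨a, ha⟩ : chartE fQ fE i)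
        (D_mem_kaehlerImage (ratio_mem_chartE fQ fE _ i)))
      (Submodule.smul_mem _ (⟨b, hb⟩ : chartE fQ fE i)
        (D_mem_kaehlerImage (ratio_mem_chartE fQ fE _ i)))
  constructor
  · intro h
    have hle : kaehlerImage (chartE fQ fE i) ≤ Submodule.span (chartE fQ fE i) {η} := by
      refine kaehlerImage_le (A := chartE fQ fE i) rfl ?_
      rintro _ ⟨j, rfl⟩
      change KaehlerDifferential.D F _ (ratio fQ fE j.castSucc i.castSucc) ∈ _
      rw [← evalChart_X, hη.D_evalChart hQ hE]
      exact Submodule.mem_span_singleton.mpr ⟨⟨_, evalChart_mem i _⟩, rfl⟩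
    obtain ⟨a, ha⟩ := Submodule.mem_span_singleton.mp (hle h)
    rw [← smul_left_injective _ hη.ne_zero (show (a : functionField fQ fE) • η = g • η from ha)]
    exact a.2
  · intro h
    exact Submodule.smul_mem _ (⟨g, h⟩ : chartE fQ fE i) hself

theorem IsInvariantDifferential.involutionDiff_smul (hη : IsInvariantDifferential η)
    (hQ : fQ.IsHomogeneous 2) (hE : fE.IsHomogeneous 3) (hsm : IsSmoothPlaneCurve fE)
    (g : functionField fQ fE) :
    involutionDiff fQ fE (g • η) = involution fQ fE g • η := by
  have h : involutionDiff fQ fE η = η := by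
    obtain ⟨a, ha, b, hb, h⟩ := hη.exists_eq_combination hQ hE hsm 0
    conv_lhs => rw [h]
    rw [involutionDiff, map_add, pullback_smul, pullback_smul, pullback_D, pullback_D,
      involution_ratio, involution_ratio, involution_of_mem_chartE ha,
      involution_of_mem_chartE hb, ← h]
  rw [involutionDiff, pullback_smul]
  exact congrArg _ h

/-- The dualizing sheaf of `Y` is generated by `η / s` on the chart `xᵢ ≠ 0`, where
`s = x₃ / xᵢ`: the trace form of `O_Y = O_E ⊕ O_E s` has the dual basis `1 / 2`, `1 / (2 s)`
of `1`, `s`. -/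
theorem IsInvariantDifferential.mem_canonicalSections (hη : IsInvariantDifferential η)
    (h2 : (2 : F) ≠ 0) (hQ : fQ.IsHomogeneous 2) (hE : fE.IsHomogeneous 3)
    (hsm : IsSmoothPlaneCurve fE) (i : Fin 3) (g : functionField fQ fE) :
    g • η ∈ canonicalSections fQ fE i ↔ g * ratio fQ fE 3 i.castSucc ∈ chartY fQ fE i := by
  have hK2 := two_ne_zero_functionField (fQ := fQ) (fE := fE) h2
  have hs := ratio_ne_zero (fQ := fQ) (fE := fE) hQ hE 3 i.castSucc
  have htrace : g • η ∈ canonicalSections fQ fE i ↔ ∀ b ∈ chartY fQ fE i,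
      b * g + involution fQ fE (b * g) ∈ chartE fQ fE i := by
    have h : ∀ b : functionField fQ fE, b • g • η + involutionDiff fQ fE (b • g • η) =
        (b * g + involution fQ fE (b * g)) • η := fun b => by
      rw [smul_smul, hη.involutionDiff_smul hQ hE hsm, add_smul]
    constructor
    · intro hω b hb
      rw [← hη.mem_kaehlerImage_chartE hQ hE hsm, ← h]
      exact hω ⟨b, hb⟩
    · intro hω b
      have := hω b b.2
      rw [← hη.mem_kaehlerImage_chartE hQ hE hsm, ← h] at this
      exact this
  rw [htrace]
  constructor
  · intro h
    have h1 := h 1 (one_mem _)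
    have h3 := h _ (ratio_mem_chartY fQ fE 3 i)
    rw [map_mul, involution_ratio_last] at h3
    rw [one_mul] at h1
    have hhalf : algebraMap F (functionField fQ fE) 2⁻¹ ∈ chartE fQ fE i := algebraMap_mem _ _
    refine (mem_chartY_iff hQ i).mpr ⟨_, mul_mem hhalf h3, _, mul_mem hhalf h1, ?_⟩
    rw [map_inv₀, map_ofNat]
    field_simp
    ring
  · intro h b hb
    obtain ⟨a, ha, a', ha', hab⟩ := (mem_chartY_iff hQ i).mp (mul_mem hb h)
    have hab' := congrArg (involution fQ fE) hab
    rw [← mul_assoc, map_mul, map_add, map_mul _ a', involution_of_mem_chartE ha,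
      involution_of_mem_chartE ha', involution_ratio_last] at hab'
    have heq : b * g + involution fQ fE (b * g) = a' + a' := by
      apply mul_right_cancel₀ hs
      linear_combination hab - hab'
    rw [heq]
    exact add_mem ha' ha'

theorem IsInvariantDifferential.smul_mem_canonicalSections (hη : IsInvariantDifferential η)
    (h2 : (2 : F) ≠ 0) (hQ : fQ.IsHomogeneous 2) (hE : fE.IsHomogeneous 3)
    (hsm : IsSmoothPlaneCurve fE) (i : Fin 3) {g : functionField fQ fE}
    (hg : g ∈ chartY fQ fE i) : g • η ∈ canonicalSections fQ fE i :=
  (hη.mem_canonicalSections h2 hQ hE hsm i g).mpr (mul_mem hg (ratio_mem_chartY fQ fE 3 i))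

theorem IsInvariantDifferential.D_ratio_last (hη : IsInvariantDifferential η)
    (h2 : (2 : F) ≠ 0) (hQ : fQ.IsHomogeneous 2) (hE : fE.IsHomogeneous 3) (i : Fin 3) :
    KaehlerDifferential.D F _ (ratio fQ fE 3 i.castSucc) =
      (-(evalChart fQ fE i (pderiv (i + 1) fQ * pderiv (i + 2) fE -
        pderiv (i + 2) fQ * pderiv (i + 1) fE) / (2 * ratio fQ fE 3 i.castSucc))) • η := by
  have hne : 2 * ratio fQ fE 3 i.castSucc ≠ 0 :=
    mul_ne_zero (two_ne_zero_functionField h2) (ratio_ne_zero hQ hE 3 _)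
  have h := congrArg ((2 * ratio fQ fE 3 i.castSucc)⁻¹ • ·) (hη.two_smul_D_ratio_last hQ hE i)
  simp only [smul_smul, inv_mul_cancel₀ hne, one_smul] at h
  rw [h]
  congr 1
  ring

/-- Kähler differentials are sections of the dualizing sheaf, whether or not `Y` is smooth. -/
theorem IsInvariantDifferential.kaehlerImage_le_canonicalSections
    (hη : IsInvariantDifferential η) (h2 : (2 : F) ≠ 0) (hQ : fQ.IsHomogeneous 2)
    (hE : fE.IsHomogeneous 3) (hsm : IsSmoothPlaneCurve fE) (i : Fin 3) :
    kaehlerImage (chartY fQ fE i) ≤ canonicalSections fQ fE i := by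
  have hK2 := two_ne_zero_functionField (fQ := fQ) (fE := fE) h2
  have hs := ratio_ne_zero (fQ := fQ) (fE := fE) hQ hE 3 i.castSucc
  refine kaehlerImage_le (A := chartY fQ fE i) rfl ?_
  rintro _ ⟨j, rfl⟩
  change KaehlerDifferential.D F _ (ratio fQ fE j i.castSucc) ∈ _
  induction j using Fin.lastCases with
  | last =>
    change KaehlerDifferential.D F _ (ratio fQ fE 3 i.castSucc) ∈ _
    rw [hη.D_ratio_last h2 hQ hE, hη.mem_canonicalSections h2 hQ hE hsm]
    generalize hm : evalChart fQ fE i _ = m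
    have hmE : m ∈ chartE fQ fE i := hm ▸ evalChart_mem i _
    have h : -(m / (2 * ratio fQ fE 3 i.castSucc)) * ratio fQ fE 3 i.castSucc =
        algebraMap F (functionField fQ fE) (-2⁻¹) * m := by
      rw [map_neg, map_inv₀, map_ofNat]
      field_simp
    rw [h]
    exact mul_mem (algebraMap_mem _ _) (chartE_le_chartY fQ fE i hmE)
  | cast j =>
    rw [← evalChart_X, hη.D_evalChart hQ hE]
    exact hη.smul_mem_canonicalSections h2 hQ hE hsm i
      (chartE_le_chartY fQ fE i (evalChart_mem i _))

theorem IsInvariantDifferential.canonicalSections_eq_kaehlerImage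
    (hη : IsInvariantDifferential η) (h2 : (2 : F) ≠ 0) (hQ : fQ.IsHomogeneous 2)
    (hE : fE.IsHomogeneous 3) (hsm : IsSmoothPlaneCurve fE) (hY : IsSmoothY fQ fE) (i : Fin 3) :
    canonicalSections fQ fE i = kaehlerImage (chartY fQ fE i) := by
  have hK2 := two_ne_zero_functionField (fQ := fQ) (fE := fE) h2
  have hs := ratio_ne_zero (fQ := fQ) (fE := fE) hQ hE 3 i.castSucc
  have hsY := ratio_mem_chartY fQ fE 3 i
  have hDs' := hη.D_ratio_last h2 hQ hE i
  have hEY := chartE_le_chartY fQ fE i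
  have hq := ratio_last_sq (fE := fE) hQ i
  set s := ratio fQ fE 3 i.castSucc
  obtain ⟨a, ha, b, hb, hab⟩ := exists_bezout_of_no_common_zero (fQ := fQ) hQ hE i fQ
    (pderiv (i + 1) fQ * pderiv (i + 2) fE - pderiv (i + 2) fQ * pderiv (i + 1) fE)
    (fun v hvi hvE hvQ => jacobian_ne_zero_of_isSmoothY hQ hE hsm hY hvi hvE hvQ)
  set m := evalChart fQ fE i
    (pderiv (i + 1) fQ * pderiv (i + 2) fE - pderiv (i + 2) fQ * pderiv (i + 1) fE)
  refine le_antisymm ?_ (hη.kaehlerImage_le_canonicalSections h2 hQ hE hsm i)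
  intro ω hω
  obtain ⟨g, rfl⟩ := hη.exists_eq_smul h2 hQ hE ω
  rw [hη.mem_canonicalSections h2 hQ hE hsm] at hω
  have hself : η ∈ kaehlerImage (chartY fQ fE i) := by
    obtain ⟨a, ha, b, hb, h⟩ := hη.exists_eq_combination hQ hE hsm i
    rw [h]
    exact add_mem
      (Submodule.smul_mem _ (⟨a, hEY ha⟩ : chartY fQ fE i)
        (D_mem_kaehlerImage (hEY (ratio_mem_chartE fQ fE _ i))))
      (Submodule.smul_mem _ (⟨b, hEY hb⟩ : chartY fQ fE i)
        (D_mem_kaehlerImage (hEY (ratio_mem_chartE fQ fE _ i))))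
  have hhalf : (2 : functionField fQ fE) ∈ chartY fQ fE i := ofNat_mem _ 2
  have hgη : g • η = (-(g * s * a * s)) • η +
      (-(g * s * (2 * b))) • KaehlerDifferential.D F _ s := by
    rw [hDs', smul_smul, ← add_smul]
    congr 1
    field_simp
    linear_combination (-g) * hab + g * a * hq
  rw [hgη]
  exact add_mem
    (Submodule.smul_mem _
      (⟨_, neg_mem (mul_mem (mul_mem hω (hEY ha)) hsY)⟩ : chartY fQ fE i) hself)
    (Submodule.smul_mem _
      (⟨_, neg_mem (mul_mem hω (mul_mem hhalf (hEY hb)))⟩ : chartY fQ fE i)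
      (D_mem_kaehlerImage hsY))

end Canonical

/-! ### Relative differentials of a double cover -/

section DoubleCover

variable {A B : Type*} [CommRing A] [CommRing B] [Algebra A B]

/-- For `B = A ⊕ A s` with `s² ∈ A`, the coefficient of `s` is a derivation from `B` to `B / s`. -/
theorem exists_derivation_quotient_span {s : B} {q : A} (hs : s ^ 2 = algebraMap A B q)
    (hgen : ∀ b : B, ∃ a a' : A, b = algebraMap A B a + a' • s)
    (huniq : ∀ a a' : A, algebraMap A B a + a' • s = 0 → a' = 0) :
    ∃ δ : Derivation A B (B ⧸ Ideal.span {s}), δ s = 1 := by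
  choose c d hcd using hgen
  have hd : ∀ b a a', b = algebraMap A B a + a' • s → d b = a' := fun b a a' h => by
    have h0 : algebraMap A B (c b - a) + (d b - a') • s = 0 := by
      rw [map_sub, sub_smul, ← add_sub_add_comm, ← hcd, ← h, sub_self]
    exact sub_eq_zero.mp (huniq _ _ h0)
  let m : B → B ⧸ Ideal.span {s} := Ideal.Quotient.mk _
  let L : B →ₗ[A] B ⧸ Ideal.span {s} :=
    { toFun := fun b => m (algebraMap A B (d b))
      map_add' := fun x y => by
        have h : d (x + y) = d x + d y := hd _ (c x + c y) _ (by
          conv_lhs => rw [hcd x, hcd y]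
          rw [map_add, add_smul]
          abel)
        rw [h, map_add]
        rfl
      map_smul' := fun r x => by
        have h : d (r • x) = r * d x := hd _ (r * c x) _ (by
          conv_lhs => rw [hcd x]
          rw [smul_add, smul_smul, map_mul, Algebra.smul_def r])
        rw [h, map_mul, RingHom.id_apply, Algebra.smul_def]
        rfl }
  refine ⟨Derivation.mk' L fun x y => ?_, ?_⟩
  · have h : d (x * y) = c x * d y + c y * d x := hd _ (c x * c y + d x * d y * q) _ (by
      conv_lhs => rw [hcd x, hcd y]
      simp only [Algebra.smul_def, map_add, map_mul]
      linear_combination (algebraMap A B (d x) * algebraMap A B (d y)) * hs)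
    change m (algebraMap A B (d (x * y))) = m (x * algebraMap A B (d y)) +
      m (y * algebraMap A B (d x))
    rw [h]
    refine (Ideal.Quotient.mk_eq_mk_iff_sub_mem _ (_ + _)).mpr ?_
    refine Ideal.mem_span_singleton'.mpr ⟨-2 * algebraMap A B (d x) * algebraMap A B (d y), ?_⟩
    have hx := hcd x
    have hy := hcd y
    rw [Algebra.smul_def] at hx hy
    rw [map_add, map_mul, map_mul]
    linear_combination algebraMap A B (d y) * hx + algebraMap A B (d x) * hy
  · have h : d s = 1 := hd s 0 1 (by rw [map_zero, one_smul, zero_add])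
    change m (algebraMap A B (d s)) = 1
    rw [h, map_one]
    rfl

theorem annihilator_kaehlerDifferential_of_sq {s : B} {q : A} (h2 : IsUnit (2 : B))
    (hs : s ^ 2 = algebraMap A B q) (hgen : ∀ b : B, ∃ a a' : A, b = algebraMap A B a + a' • s)
    (huniq : ∀ a a' : A, algebraMap A B a + a' • s = 0 → a' = 0) :
    Module.annihilator B Ω[B⁄A] = Ideal.span {s} := by
  refine le_antisymm (fun b hb => ?_) ?_
  · obtain ⟨δ, hδ⟩ := exists_derivation_quotient_span hs hgen huniq
    have h := congrArg δ.liftKaehlerDifferential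
      (Module.mem_annihilator.mp hb (KaehlerDifferential.D A B s))
    rw [map_smul, Derivation.liftKaehlerDifferential_comp_D, hδ, map_zero] at h
    refine Ideal.Quotient.eq_zero_iff_mem.mp (Eq.trans ?_ h)
    exact (congrArg (Ideal.Quotient.mk _) (mul_one b)).symm
  · rw [Ideal.span_singleton_le_iff_mem, Module.mem_annihilator]
    have h0 : s • KaehlerDifferential.D A B s = 0 := by
      have h := congrArg (KaehlerDifferential.D A B) hs
      rw [Derivation.map_algebraMap, sq, Derivation.leibniz, ← two_smul B] at h
      exact (IsUnit.smul_eq_zero h2).mp h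
    intro ω
    have hω : ω ∈ Submodule.span B (Set.range (KaehlerDifferential.D A B)) := by
      rw [KaehlerDifferential.span_range_derivation]
      trivial
    induction hω using Submodule.span_induction with
    | mem ω hω =>
      obtain ⟨b, rfl⟩ := hω
      obtain ⟨a, a', rfl⟩ := hgen b
      rw [map_add, Derivation.map_algebraMap, zero_add, Derivation.map_smul, smul_comm, h0,
        smul_zero]
    | zero => exact smul_zero s
    | add ω η _ _ hω hη => rw [smul_add, hω, hη, add_zero]
    | smul a ω _ hω => rw [smul_comm, hω, smul_zero]

end DoubleCover

section Ramification

variable {F : Type*} [Field F] {fQ fE : MvPolynomial (Fin 3) F} [(idealY fQ fE).IsPrime]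

/-- The ramification divisor of `Y → E` is the plane section `x₃ = 0`. -/
theorem ramification_eq (h2 : (2 : F) ≠ 0) (hQ : fQ.IsHomogeneous 2) (hE : fE.IsHomogeneous 3) :
    ramification fQ fE = planeSection fQ fE (Pi.single 3 1) := by
  funext i
  have hK2 := two_ne_zero_functionField (fQ := fQ) (fE := fE) h2
  have hs := ratio_ne_zero (fQ := fQ) (fE := fE) hQ hE 3 i.castSucc
  let f := (Subalgebra.inclusion (chartE_le_chartY fQ fE i)).toRingHom
  let s : chartY fQ fE i := ⟨_, ratio_mem_chartY fQ fE 3 i⟩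
  have hplane : planeSection fQ fE (Pi.single 3 1) i = Ideal.span {s} := by
    rw [planeSection, Finset.sum_eq_single 3 (fun j _ hj => by
      rw [Pi.single_eq_of_ne hj, zero_smul]) (by simp), Pi.single_eq_same, one_smul]
  rw [hplane]
  let _ : Algebra (chartE fQ fE i) (chartY fQ fE i) := f.toAlgebra
  refine annihilator_kaehlerDifferential_of_sq (A := chartE fQ fE i) (s := s)
    (q := ⟨_, evalChart_mem i (-fQ)⟩) ?_ ?_ ?_ ?_
  · refine IsUnit.of_mul_eq_one (algebraMap F _ 2⁻¹) ?_
    rw [← map_ofNat (algebraMap F (chartY fQ fE i)) 2, ← map_mul, mul_inv_cancel₀ h2, map_one]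
  · refine Subtype.ext ?_
    change ratio fQ fE 3 i.castSucc ^ 2 = evalChart fQ fE i (-fQ)
    rw [map_neg, ratio_last_sq hQ]
  · intro b
    obtain ⟨a, ha, a', ha', h⟩ := (mem_chartY_iff hQ i).mp b.2
    exact ⟨⟨a, ha⟩, ⟨a', ha'⟩, Subtype.ext h⟩
  · intro a a' h
    have h1 : (a : functionField fQ fE) + a' * ratio fQ fE 3 i.castSucc = 0 :=
      congrArg Subtype.val h
    have h3 := congrArg (involution fQ fE) h1
    rw [map_add, map_mul, involution_of_mem_chartE a.2, involution_of_mem_chartE a'.2,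
      involution_ratio_last, map_zero] at h3
    have h4 : (2 * ratio fQ fE 3 i.castSucc) * (a' : functionField fQ fE) = 0 := by
      linear_combination h1 - h3
    exact Subtype.ext ((mul_eq_zero.mp h4).resolve_left (mul_ne_zero hK2 hs))

end Ramification

/-! ### Global sections -/

section Global

variable {F : Type*} [Field F] {fQ fE : MvPolynomial (Fin 3) F} [(idealY fQ fE).IsPrime]

variable (fQ fE) in
/-- The rational function `(c₀ x₀ + c₁ x₁ + c₂ x₂ + c₃ x₃) / xₖ`. -/
noncomputable def linearRatio (k : Fin 4) : (Fin 4 → F) →ₗ[F] functionField fQ fE :=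
  Fintype.linearCombination F fun j => ratio fQ fE j k

theorem linearRatio_apply (k : Fin 4) (c : Fin 4 → F) :
    linearRatio fQ fE k c = ∑ j, c j • ratio fQ fE j k := rfl

theorem linearRatio_mem_chartY (i : Fin 3) (c : Fin 4 → F) :
    linearRatio fQ fE i.castSucc c ∈ chartY fQ fE i := by
  rw [linearRatio_apply]
  exact sum_mem fun j _ => Subalgebra.smul_mem _ (ratio_mem_chartY fQ fE j i) (c j)

theorem planeSection_eq (c : Fin 4 → F) (i : Fin 3) :
    planeSection fQ fE c i = Ideal.span {⟨_, linearRatio_mem_chartY i c⟩} := by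
  rw [planeSection]
  congr 2

section Homogeneous

variable (hQ : fQ.IsHomogeneous 2) (hE : fE.IsHomogeneous 3)
include hQ hE

theorem linearRatio_mul_ratio (k l : Fin 4) (c : Fin 4 → F) :
    linearRatio fQ fE k c * ratio fQ fE k l = linearRatio fQ fE l c := by
  rw [linearRatio_apply, linearRatio_apply, Finset.sum_mul]
  refine Finset.sum_congr rfl fun j _ => ?_
  rw [smul_mul_assoc, ratio_mul_ratio hQ hE]

theorem linearRatio_injective (k : Fin 4) : Function.Injective (linearRatio fQ fE k) := by
  rw [injective_iff_map_eq_zero]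
  intro c hc
  refine eq_zero_of_sum_coord hQ hE ?_
  have h := congrArg (fun x : functionField fQ fE => (x : ConeField fQ fE) * coord fQ fE k) hc
  simp only [linearRatio_apply, ZeroMemClass.coe_zero, zero_mul] at h
  rw [← h, AddSubmonoidClass.coe_finsetSum, Finset.sum_mul]
  refine Finset.sum_congr rfl fun j _ => ?_
  change _ = (c j • (coord fQ fE j / coord fQ fE k)) * coord fQ fE k
  rw [smul_mul_assoc, div_mul_cancel₀ _ (coord_ne_zero hQ hE k)]

/-- The regular functions on `E` are constant. -/
theorem exists_algebraMap_of_forall_mem_chartE (hE0 : fE ≠ 0) {x : functionField fQ fE}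
    (hx : ∀ i, x ∈ chartE fQ fE i) : ∃ r : F, x = algebraMap F _ r := by
  obtain ⟨q, hq, h⟩ := exists_form_of_forall_chart (n := 0) hQ hE hE0 (a := (x : ConeField fQ fE))
    fun i => ⟨x, hx i, by rw [pow_zero, mul_one]⟩
  rw [totalDegree_eq_zero_iff_eq_C.mp (Nat.le_zero.mp hq.totalDegree_le), evalCone, aeval_C] at h
  exact ⟨_, Subtype.ext h⟩

/-- The sections of `𝒪_E(1)` are the linear forms in `x₀, x₁, x₂`. -/
theorem exists_linear_of_forall_mul_mem_chartE (hE0 : fE ≠ 0) {x : functionField fQ fE}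
    (hx : ∀ i : Fin 3, x * ratio fQ fE 3 i.castSucc ∈ chartE fQ fE i) :
    ∃ d : Fin 3 → F, x = ∑ j, d j • ratio fQ fE j.castSucc 3 := by
  have h3 := coord_ne_zero (fQ := fQ) (fE := fE) hQ hE 3
  obtain ⟨q, hq, h⟩ := exists_form_of_forall_chart (n := 1) hQ hE hE0
    (a := (x : ConeField fQ fE) * coord fQ fE 3) fun i => ⟨_, hx i, by
      change _ = (x : ConeField fQ fE) * (coord fQ fE 3 / coord fQ fE i.castSucc) * _
      rw [pow_one, mul_assoc, div_mul_cancel₀ _ (coord_ne_zero hQ hE _)]⟩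
  have hC : ∀ j, pderiv j q = C (coeff 0 (pderiv j q)) := fun j =>
    totalDegree_eq_zero_iff_eq_C.mp (Nat.le_zero.mp (hq.pderiv (i := j)).totalDegree_le)
  refine ⟨fun j => coeff 0 (pderiv j q), Subtype.ext ?_⟩
  have heu := hq.sum_X_mul_pderiv
  rw [one_smul] at heu
  rw [← heu, map_sum] at h
  rw [AddSubmonoidClass.coe_finsetSum, ← mul_div_cancel_right₀ (x : ConeField fQ fE) h3, h,
    Finset.sum_div]
  refine Finset.sum_congr rfl fun j _ => ?_
  rw [map_mul, evalCone_X, hC j, evalCone, aeval_C, mul_comm, ← Algebra.smul_def,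
    smul_div_assoc]
  rfl

/-- The even and odd parts of a function on a chart of `Y`. -/
theorem even_odd_of_mem_chartY {i : Fin 3} {x : functionField fQ fE}
    (hx : x ∈ chartY fQ fE i) : x + involution fQ fE x ∈ chartE fQ fE i ∧
      (x - involution fQ fE x) * ratio fQ fE i.castSucc 3 ∈ chartE fQ fE i := by
  obtain ⟨a, ha, b, hb, rfl⟩ := (mem_chartY_iff hQ i).mp hx
  have hinv : ratio fQ fE 3 i.castSucc * ratio fQ fE i.castSucc 3 = 1 := by
    rw [ratio_mul_ratio hQ hE, ratio_self hQ hE]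
  rw [map_add, map_mul, involution_of_mem_chartE ha, involution_of_mem_chartE hb,
    involution_ratio_last]
  constructor
  · convert add_mem ha ha using 1
    ring
  · convert add_mem hb hb using 1
    linear_combination (2 * b) * hinv

/-- The regular functions on `Y` are constant (even if `Y` is not geometrically integral). -/
theorem exists_algebraMap_of_forall_mem_chartY (h2 : (2 : F) ≠ 0) (hE0 : fE ≠ 0)
    {x : functionField fQ fE} (hx : ∀ i, x ∈ chartY fQ fE i) : ∃ r : F, x = algebraMap F _ r := by
  obtain ⟨r, hr⟩ := exists_algebraMap_of_forall_mem_chartE hQ hE hE0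
    fun i => (even_odd_of_mem_chartY hQ hE (hx i)).1
  -- The odd part is `x₃` times a section of `𝒪_E(-1)`; its products with the `xⱼ` are constant.
  have hodd : ∀ j : Fin 3, ∃ t : F,
      (x - involution fQ fE x) * ratio fQ fE j.castSucc 3 = algebraMap F _ t := fun j =>
    exists_algebraMap_of_forall_mem_chartE hQ hE hE0 fun i => by
      convert mul_mem (even_odd_of_mem_chartY hQ hE (hx i)).2 (ratio_mem_chartE fQ fE j i) using 1
      rw [mul_assoc, mul_comm (ratio fQ fE i.castSucc 3), ratio_mul_ratio hQ hE]
  obtain ⟨t0, h0⟩ := hodd 0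
  obtain ⟨t1, h1⟩ := hodd 1
  have ht : linearRatio fQ fE 3 (t0 • Pi.single 1 1 - t1 • Pi.single 0 1) = 0 := by
    have hsingle : ∀ j, linearRatio fQ fE 3 (Pi.single j 1) = ratio fQ fE j 3 := fun j =>
      (Fintype.linearCombination_apply_single F _ j 1).trans (one_smul _ _)
    rw [map_sub, map_smul, map_smul, hsingle, hsingle, Algebra.smul_def, Algebra.smul_def, ← h0,
      ← h1]
    change _ * ratio fQ fE 0 3 * ratio fQ fE 1 3 - _ * ratio fQ fE 1 3 * ratio fQ fE 0 3 = 0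
    ring
  have ht0 : t0 = 0 := by
    have h := congrFun (linearRatio_injective hQ hE 3 (ht.trans (map_zero _).symm)) 1
    simpa using h
  rw [ht0, map_zero] at h0
  have hx0 := (mul_eq_zero.mp h0).resolve_right (ratio_ne_zero hQ hE _ _)
  refine ⟨2⁻¹ * r, ?_⟩
  rw [map_mul, ← hr, map_inv₀, map_ofNat]
  field_simp [two_ne_zero_functionField (fQ := fQ) (fE := fE) h2]
  linear_combination hx0

/-- A plane is determined by its intersection with `Y`. -/
theorem planeSection_eq_iff (h2 : (2 : F) ≠ 0) (hE0 : fE ≠ 0) {c c' : Fin 4 → F} (hc' : c' ≠ 0)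
    (hc : c ≠ 0) :
    planeSection fQ fE c = planeSection fQ fE c' ↔ ∃ a : F, a • c' = c := by
  constructor
  · intro h
    have hne : ∀ k, linearRatio fQ fE k c' ≠ 0 := fun k h0 =>
      hc' (linearRatio_injective hQ hE k (h0.trans (map_zero _).symm))
    have hmem : ∀ i, linearRatio fQ fE 3 c / linearRatio fQ fE 3 c' ∈ chartY fQ fE i := fun i => by
      have hi := congrFun h i
      rw [planeSection_eq, planeSection_eq] at hi
      obtain ⟨u, hu⟩ := Ideal.mem_span_singleton'.mp (hi ▸ Ideal.mem_span_singleton_self _)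
      have hu' : (u : functionField fQ fE) * linearRatio fQ fE i.castSucc c' =
        linearRatio fQ fE i.castSucc c := congrArg Subtype.val hu
      have hquot : linearRatio fQ fE 3 c / linearRatio fQ fE 3 c' = u := by
        rw [div_eq_iff (hne 3), ← linearRatio_mul_ratio hQ hE i.castSucc 3 c, ← hu', mul_assoc,
          linearRatio_mul_ratio hQ hE]
      rw [hquot]
      exact u.2
    obtain ⟨r, hr⟩ := exists_algebraMap_of_forall_mem_chartY hQ hE h2 hE0 hmem
    refine ⟨r, linearRatio_injective hQ hE 3 ?_⟩
    rw [map_smul, Algebra.smul_def, ← hr, div_mul_cancel₀ _ (hne 3)]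
  · rintro ⟨a, rfl⟩
    have ha : a ≠ 0 := fun h => hc (by rw [h, zero_smul])
    funext i
    rw [planeSection_eq, planeSection_eq]
    have h : (⟨_, linearRatio_mem_chartY i (a • c')⟩ : chartY fQ fE i) =
        algebraMap F (chartY fQ fE i) a * ⟨_, linearRatio_mem_chartY i c'⟩ := by
      refine Subtype.ext ?_
      change linearRatio fQ fE i.castSucc (a • c') = algebraMap F _ a * _
      rw [map_smul, Algebra.smul_def]
    rw [h]
    exact Ideal.span_singleton_mul_left_unit ((IsUnit.mk0 a ha).map _) _

end Homogeneous

variable {η : RatDiff fQ fE}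

/-- The zero divisor of `g η` is given by `g s`, as `η / s` generates the dualizing sheaf. -/
theorem IsInvariantDifferential.zeroDivisor_smul (hη : IsInvariantDifferential η)
    (h2 : (2 : F) ≠ 0) (hQ : fQ.IsHomogeneous 2) (hE : fE.IsHomogeneous 3)
    (hsm : IsSmoothPlaneCurve fE) (i : Fin 3) {g : functionField fQ fE}
    (hg : g * ratio fQ fE 3 i.castSucc ∈ chartY fQ fE i) :
    zeroDivisor fQ fE (g • η) i = Ideal.span {⟨_, hg⟩} := by
  have hs := ratio_ne_zero (fQ := fQ) (fE := fE) hQ hE 3 i.castSucc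
  ext b
  rw [zeroDivisor, Submodule.mem_colon, Ideal.mem_span_singleton']
  constructor
  · intro h
    have h1 := h ((ratio fQ fE 3 i.castSucc)⁻¹ • η) (by
      rw [SetLike.mem_coe, hη.mem_canonicalSections h2 hQ hE hsm, inv_mul_cancel₀ hs]
      exact one_mem _)
    obtain ⟨c, hc⟩ := Submodule.mem_span_singleton.mp h1
    have hc' : ((c : functionField fQ fE) * g) • η =
        ((b : functionField fQ fE) * (ratio fQ fE 3 i.castSucc)⁻¹) • η := by
      rw [mul_smul, mul_smul]
      exact hc
    have hc2 := smul_left_injective _ hη.ne_zero hc'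
    refine ⟨c, Subtype.ext ?_⟩
    change (c : functionField fQ fE) * (g * ratio fQ fE 3 i.castSucc) = b
    rw [← mul_assoc, show (c : functionField fQ fE) * g = _ from hc2, inv_mul_cancel_right₀ hs]
  · rintro ⟨c, rfl⟩ ω hω
    obtain ⟨k, rfl⟩ := hη.exists_eq_smul h2 hQ hE ω
    rw [SetLike.mem_coe, hη.mem_canonicalSections h2 hQ hE hsm] at hω
    refine Submodule.mem_span_singleton.mpr ⟨c * ⟨_, hω⟩, ?_⟩
    change ((c : functionField fQ fE) * (k * ratio fQ fE 3 i.castSucc)) • g • η =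
      ((c : functionField fQ fE) * (g * ratio fQ fE 3 i.castSucc)) • k • η
    rw [smul_smul, smul_smul]
    congr 1
    ring

theorem mem_globalDiff {ω : RatDiff fQ fE} :
    ω ∈ globalDiff fQ fE ↔ ∀ i, ω ∈ canonicalSections fQ fE i := by
  rw [globalDiff, Submodule.mem_iInf]
  rfl

/-- Every global section of the dualizing sheaf is `ℓ / x₃ · η` with a linear form `ℓ`: its even
part gives a regular function on `E` and its odd part a section of `𝒪_E(1)`. -/
theorem IsInvariantDifferential.mem_globalDiff_iff (hη : IsInvariantDifferential η)
    (h2 : (2 : F) ≠ 0) (hQ : fQ.IsHomogeneous 2) (hE : fE.IsHomogeneous 3)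
    (hsm : IsSmoothPlaneCurve fE) (ω : RatDiff fQ fE) :
    ω ∈ globalDiff fQ fE ↔ ∃ c, linearRatio fQ fE 3 c • η = ω := by
  have hE0 := ne_zero_of_isSmoothPlaneCurve hsm
  rw [mem_globalDiff]
  constructor
  · intro h
    obtain ⟨g, rfl⟩ := hη.exists_eq_smul h2 hQ hE ω
    have hg : ∀ i : Fin 3, g * ratio fQ fE 3 i.castSucc ∈ chartY fQ fE i := fun i =>
      (hη.mem_canonicalSections h2 hQ hE hsm i g).mp (h i)
    have hinv : ∀ i : Fin 3, ratio fQ fE 3 i.castSucc * ratio fQ fE i.castSucc 3 = 1 := fun i => by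
      rw [ratio_mul_ratio hQ hE, ratio_self hQ hE]
    obtain ⟨r, hr⟩ := exists_algebraMap_of_forall_mem_chartE hQ hE hE0
      (x := g + involution fQ fE g) fun i => by
        convert (even_odd_of_mem_chartY hQ hE (hg i)).2 using 1
        rw [map_mul, involution_ratio_last]
        linear_combination (-(g + involution fQ fE g)) * hinv i
    obtain ⟨d, hd⟩ := exists_linear_of_forall_mul_mem_chartE hQ hE hE0
      (x := g - involution fQ fE g) fun i => by
        convert (even_odd_of_mem_chartY hQ hE (hg i)).1 using 1
        rw [map_mul, involution_ratio_last]
        ring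
    refine ⟨(2⁻¹ : F) • Fin.snoc (α := fun _ => F) d r, ?_⟩
    congr 1
    rw [map_smul, linearRatio_apply, Fin.sum_univ_castSucc]
    simp only [Fin.snoc_castSucc, Fin.snoc_last]
    rw [← hd, Algebra.smul_def, map_inv₀, map_ofNat,
      show ratio fQ fE (Fin.last 3) 3 = 1 from ratio_self hQ hE 3, Algebra.smul_def, ← hr]
    field_simp [two_ne_zero_functionField (fQ := fQ) (fE := fE) h2]
    ring
  · rintro ⟨c, rfl⟩ i
    rw [hη.mem_canonicalSections h2 hQ hE hsm, linearRatio_mul_ratio hQ hE]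
    exact linearRatio_mem_chartY i c

end Global

/-! ### Plane sections and the canonical linear system -/

section Projective

variable {F V W : Type*} [Field F] [AddCommGroup V] [Module F V] [AddCommGroup W] [Module F W]

theorem rep_mk_mem_iff (U : Submodule F V) {v : V} (hv : v ≠ 0) :
    (Projectivization.mk F v hv).rep ∈ U ↔ v ∈ U := by
  obtain ⟨a, ha⟩ := Projectivization.exists_smul_eq_mk_rep F v hv
  rw [← ha]
  exact U.smul_mem_iff' a

theorem map_eq_mk_rep (f : V →ₗ[F] W) (hf : Function.Injective f) (P : ℙ F V) :
    Projectivization.map f hf P =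
      Projectivization.mk F (f P.rep) ((map_ne_zero_iff f hf).mpr P.rep_nonzero) := by
  conv_lhs => rw [← P.mk_rep]
  rfl

theorem eq_mk_iff {P : ℙ F V} {v : V} (hv : v ≠ 0) :
    P = Projectivization.mk F v hv ↔ ∃ a : F, a • v = P.rep := by
  rw [← Projectivization.mk_eq_mk_iff' F P.rep v P.rep_nonzero hv, P.mk_rep]

theorem mem_range_map_subtype (U : Submodule F V) (P : ℙ F V) :
    P ∈ Set.range (Projectivization.map U.subtype U.injective_subtype) ↔ P.rep ∈ U := by
  constructor
  · rintro ⟨Q, rfl⟩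
    rw [map_eq_mk_rep, rep_mk_mem_iff]
    exact Q.rep.2
  · intro h
    refine ⟨Projectivization.mk F ⟨P.rep, h⟩ (fun h0 => P.rep_nonzero (congrArg Subtype.val h0)),
      ?_⟩
    exact P.mk_rep

theorem map_subtype_eq_mk_iff {V' : Type*} [AddCommGroup V'] [Module F V'] {U : Submodule F V}
    (e : V' →ₗ[F] U) (he : Function.Injective e) (L : ℙ F V') {v : V} (hv : v ≠ 0)
    (h : (e L.rep : V) = v) (P : ℙ F U) :
    Projectivization.map U.subtype U.injective_subtype P = Projectivization.mk F v hv ↔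
      P = Projectivization.map e he L := by
  subst h
  have hL : Projectivization.mk F (e L.rep : V) hv =
      Projectivization.map U.subtype U.injective_subtype (Projectivization.map e he L) := by
    rw [map_eq_mk_rep e]
    rfl
  rw [hL]
  exact (Projectivization.map_injective _ U.injective_subtype).eq_iff

end Projective

section Identification

variable {F : Type*} [Field F] {fQ fE : MvPolynomial (Fin 3) F} [(idealY fQ fE).IsPrime]
  {η : RatDiff fQ fE}

/-- The linear isomorphism `ℓ ↦ (ℓ / x₃) η` from linear forms to differentials. -/
theorem IsInvariantDifferential.exists_linearEquiv (hη : IsInvariantDifferential η)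
    (h2 : (2 : F) ≠ 0) (hQ : fQ.IsHomogeneous 2) (hE : fE.IsHomogeneous 3)
    (hsm : IsSmoothPlaneCurve fE) :
    ∃ κ : (Fin 4 → F) ≃ₗ[F] globalDiff fQ fE,
      ∀ c, (κ c : RatDiff fQ fE) = linearRatio fQ fE 3 c • η := by
  let φ : (Fin 4 → F) →ₗ[F] RatDiff fQ fE :=
    ((LinearMap.toSpanSingleton (functionField fQ fE) _ η).restrictScalars F).comp
      (linearRatio fQ fE 3)
  have hφ : ∀ c, φ c = linearRatio fQ fE 3 c • η := fun c => rfl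
  let ψ : (Fin 4 → F) →ₗ[F] globalDiff fQ fE := φ.codRestrict _ fun c =>
    (hη.mem_globalDiff_iff h2 hQ hE hsm _).mpr ⟨c, rfl⟩
  refine ⟨LinearEquiv.ofBijective ψ ⟨?_, ?_⟩, fun c => rfl⟩
  · intro c c' h
    have h1 : linearRatio fQ fE 3 c • η = linearRatio fQ fE 3 c' • η := congrArg Subtype.val h
    exact linearRatio_injective hQ hE 3 (smul_left_injective _ hη.ne_zero h1)
  · intro ω
    obtain ⟨c, hc⟩ := (hη.mem_globalDiff_iff h2 hQ hE hsm _).mp ω.2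
    exact ⟨c, Subtype.ext hc⟩

variable {κ : (Fin 4 → F) ≃ₗ[F] globalDiff fQ fE}

theorem IsInvariantDifferential.zeroDivisor_eq_planeSection (hη : IsInvariantDifferential η)
    (hκ : ∀ c, (κ c : RatDiff fQ fE) = linearRatio fQ fE 3 c • η)
    (h2 : (2 : F) ≠ 0) (hQ : fQ.IsHomogeneous 2) (hE : fE.IsHomogeneous 3)
    (hsm : IsSmoothPlaneCurve fE) (c : Fin 4 → F) :
    zeroDivisor fQ fE (κ c : RatDiff fQ fE) = planeSection fQ fE c := by
  funext i
  have hm := linearRatio_mul_ratio (fQ := fQ) (fE := fE) hQ hE 3 i.castSucc c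
  have hg : linearRatio fQ fE 3 c * ratio fQ fE 3 i.castSucc ∈ chartY fQ fE i := by
    rw [hm]
    exact linearRatio_mem_chartY i c
  rw [hκ, hη.zeroDivisor_smul h2 hQ hE hsm i hg, planeSection_eq]
  exact congrArg (fun x => Ideal.span {x}) (Subtype.ext hm)

/-- The divisor of a point of `|K_Y|` is a given plane section exactly if the point corresponds to
this plane. -/
theorem IsInvariantDifferential.canonicalDivisor_eq_iff (hη : IsInvariantDifferential η)
    (hκ : ∀ c, (κ c : RatDiff fQ fE) = linearRatio fQ fE 3 c • η)
    (h2 : (2 : F) ≠ 0) (hQ : fQ.IsHomogeneous 2) (hE : fE.IsHomogeneous 3)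
    (hsm : IsSmoothPlaneCurve fE) (P : ℙ F (globalDiff fQ fE)) {c : Fin 4 → F} (hc : c ≠ 0) :
    canonicalDivisor fQ fE P = planeSection fQ fE c ↔
      P = Projectivization.mk F (κ c) ((map_ne_zero_iff κ κ.injective).mpr hc) := by
  have hE0 := ne_zero_of_isSmoothPlaneCurve hsm
  obtain ⟨d, hd⟩ := κ.surjective P.rep
  have hd0 : d ≠ 0 := by
    rintro rfl
    exact P.rep_nonzero (by rw [← hd, map_zero])
  have h : canonicalDivisor fQ fE P = planeSection fQ fE d := by
    rw [← hη.zeroDivisor_eq_planeSection hκ h2 hQ hE hsm, hd]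
    rfl
  rw [eq_mk_iff, h, planeSection_eq_iff hQ hE h2 hE0 hc hd0]
  refine exists_congr fun a => ?_
  rw [← hd, ← map_smul, κ.injective.eq_iff]

theorem involution_linearRatio (hQ : fQ.IsHomogeneous 2) (hE : fE.IsHomogeneous 3)
    (c : Fin 4 → F) : involution fQ fE (linearRatio fQ fE 3 c) =
      linearRatio fQ fE 3 (fun j => if j = 3 then c j else -c j) := by
  rw [linearRatio_apply, linearRatio_apply, map_sum]
  refine Finset.sum_congr rfl fun j _ => ?_
  rw [map_smul]
  induction j using Fin.lastCases with
  | last =>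
    rw [show ratio fQ fE (Fin.last 3) 3 = 1 from ratio_self hQ hE 3, map_one]
    rfl
  | cast j =>
    rw [involution_ratio_last', if_neg (show j.castSucc ≠ (3 : Fin 4) from Fin.castSucc_ne_last j),
      smul_neg, neg_smul]

theorem IsInvariantDifferential.involutionDiff_eq (hη : IsInvariantDifferential η)
    (hκ : ∀ c, (κ c : RatDiff fQ fE) = linearRatio fQ fE 3 c • η)
    (hQ : fQ.IsHomogeneous 2) (hE : fE.IsHomogeneous 3) (hsm : IsSmoothPlaneCurve fE)
    (c : Fin 4 → F) :
    involutionDiff fQ fE (κ c) = κ (fun j => if j = 3 then c j else -c j) := by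
  rw [hκ, hκ, hη.involutionDiff_smul hQ hE hsm, involution_linearRatio hQ hE]

theorem IsInvariantDifferential.mem_evenDiff (hη : IsInvariantDifferential η)
    (hκ : ∀ c, (κ c : RatDiff fQ fE) = linearRatio fQ fE 3 c • η)
    (h2 : (2 : F) ≠ 0) (hQ : fQ.IsHomogeneous 2) (hE : fE.IsHomogeneous 3)
    (hsm : IsSmoothPlaneCurve fE) (c : Fin 4 → F) :
    κ c ∈ evenDiff fQ fE ↔ c ∈ Submodule.span F {(Pi.single 3 1 : Fin 4 → F)} := by
  have h : κ c ∈ evenDiff fQ fE ↔ involutionDiff fQ fE (κ c) = κ c := by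
    rw [evenDiff, Submodule.mem_comap, LinearMap.mem_ker, LinearMap.sub_apply, sub_eq_zero]
    rfl
  rw [h, hη.involutionDiff_eq hκ hQ hE hsm, SetLike.coe_eq_coe, κ.injective.eq_iff,
    Submodule.mem_span_singleton]
  constructor
  · intro hc
    refine ⟨c 3, funext fun j => ?_⟩
    have hj := congrFun hc j
    by_cases h3 : j = 3
    · subst h3
      simp
    · rw [if_neg h3, neg_eq_iff_add_eq_zero, ← two_mul] at hj
      simp [h3, (mul_eq_zero.mp hj).resolve_left h2]
  · rintro ⟨r, rfl⟩
    ext j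
    by_cases h3 : j = 3 <;> simp [h3]

theorem IsInvariantDifferential.mem_oddDiff (hη : IsInvariantDifferential η)
    (hκ : ∀ c, (κ c : RatDiff fQ fE) = linearRatio fQ fE 3 c • η)
    (h2 : (2 : F) ≠ 0) (hQ : fQ.IsHomogeneous 2) (hE : fE.IsHomogeneous 3)
    (hsm : IsSmoothPlaneCurve fE) (c : Fin 4 → F) :
    κ c ∈ oddDiff fQ fE ↔ c 3 = 0 := by
  have h : κ c ∈ oddDiff fQ fE ↔ involutionDiff fQ fE (κ c) = -κ c := by
    rw [oddDiff, Submodule.mem_comap, LinearMap.mem_ker, LinearMap.add_apply,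
      add_eq_zero_iff_eq_neg]
    rfl
  rw [h, hη.involutionDiff_eq hκ hQ hE hsm, ← NegMemClass.coe_neg, SetLike.coe_eq_coe, ← map_neg,
    κ.injective.eq_iff]
  constructor
  · intro hc
    have hj := congrFun hc 3
    rw [if_pos rfl, Pi.neg_apply, eq_neg_iff_add_eq_zero, ← two_mul] at hj
    exact (mul_eq_zero.mp hj).resolve_left h2
  · intro hc
    ext j
    by_cases h3 : j = 3
    · subst h3
      simp [hc]
    · simp [h3]

variable (F) in
/-- The linear form `c₀ x₀ + c₁ x₁ + c₂ x₂` on `H`, as a form on `ℙ³` that vanishes at the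
vertex. -/
noncomputable def extendForm : (Fin 3 → F) →ₗ[F] (Fin 4 → F) :=
  LinearMap.pi (Fin.lastCases (motive := fun _ => (Fin 3 → F) →ₗ[F] F) 0 fun j => LinearMap.proj j)

theorem extendForm_castSucc (c : Fin 3 → F) (j : Fin 3) : extendForm F c j.castSucc = c j :=
  DFunLike.congr_fun (Fin.lastCases_castSucc (motive := fun _ => (Fin 3 → F) →ₗ[F] F) ..) c

theorem extendForm_last (c : Fin 3 → F) : extendForm F c 3 = 0 :=
  DFunLike.congr_fun (Fin.lastCases_last (n := 3) (motive := fun _ => (Fin 3 → F) →ₗ[F] F)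
    (last := 0) (cast := fun j => LinearMap.proj j)) c

theorem extendForm_injective : Function.Injective (extendForm F) := fun c d h => by
  ext j
  rw [← extendForm_castSucc c, h, extendForm_castSucc]

theorem extendForm_ne_zero {c : Fin 3 → F} (hc : c ≠ 0) : extendForm F c ≠ 0 :=
  (map_ne_zero_iff _ extendForm_injective).mpr hc

theorem lineSectionPullback_eq (c : Fin 3 → F) :
    lineSectionPullback fQ fE c = planeSection fQ fE (extendForm F c) := by
  funext i
  rw [lineSectionPullback, planeSection, Ideal.map_span, Set.image_singleton,
    Fin.sum_univ_castSucc (n := 3), show extendForm F c (Fin.last 3) = 0 from extendForm_last c,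
    zero_smul, add_zero, map_sum]
  refine congrArg (fun x => Ideal.span {x}) (Finset.sum_congr rfl fun j _ => ?_)
  rw [extendForm_castSucc]
  rfl

theorem IsInvariantDifferential.exists_linearEquiv_oddDiff (hη : IsInvariantDifferential η)
    (hκ : ∀ c, (κ c : RatDiff fQ fE) = linearRatio fQ fE 3 c • η)
    (h2 : (2 : F) ≠ 0) (hQ : fQ.IsHomogeneous 2) (hE : fE.IsHomogeneous 3)
    (hsm : IsSmoothPlaneCurve fE) :
    ∃ e : (Fin 3 → F) ≃ₗ[F] oddDiff fQ fE,
      ∀ c, (e c : globalDiff fQ fE) = κ (extendForm F c) := by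
  let ψ : (Fin 3 → F) →ₗ[F] oddDiff fQ fE :=
    (κ.toLinearMap.comp (extendForm F)).codRestrict _ fun c =>
      (hη.mem_oddDiff hκ h2 hQ hE hsm _).mpr (extendForm_last c)
  refine ⟨LinearEquiv.ofBijective ψ ⟨?_, ?_⟩, fun c => rfl⟩
  · intro c d h
    exact extendForm_injective (κ.injective (congrArg Subtype.val h))
  · intro ω
    obtain ⟨c, hc⟩ := κ.surjective ω
    have h3 := (hη.mem_oddDiff hκ h2 hQ hE hsm c).mp (hc ▸ ω.2)
    refine ⟨fun j => c j.castSucc, Subtype.ext (Eq.trans (congrArg κ ?_) hc)⟩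
    ext j
    induction j using Fin.lastCases with
    | last => exact (extendForm_last _).trans h3.symm
    | cast j => rw [extendForm_castSucc]

theorem IsInvariantDifferential.finrank_evenDiff (hη : IsInvariantDifferential η)
    (hκ : ∀ c, (κ c : RatDiff fQ fE) = linearRatio fQ fE 3 c • η)
    (h2 : (2 : F) ≠ 0) (hQ : fQ.IsHomogeneous 2) (hE : fE.IsHomogeneous 3)
    (hsm : IsSmoothPlaneCurve fE) : Module.finrank F (evenDiff fQ fE) = 1 := by
  have h : evenDiff fQ fE =
      (Submodule.span F {(Pi.single 3 1 : Fin 4 → F)}).map κ.toLinearMap := by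
    ext ω
    obtain ⟨c, rfl⟩ := κ.surjective ω
    rw [hη.mem_evenDiff hκ h2 hQ hE hsm]
    exact ⟨fun h => ⟨c, h, rfl⟩, fun ⟨d, hd, h⟩ => κ.injective h ▸ hd⟩
  rw [h, LinearEquiv.finrank_map_eq, finrank_span_singleton]
  simp

theorem map_mk_rep_eq (Λ : ℙ F (Fin 4 → F)) :
    Projectivization.map κ.toLinearMap κ.injective Λ =
      Projectivization.mk F (κ Λ.rep) ((map_ne_zero_iff κ κ.injective).mpr Λ.rep_nonzero) :=
  map_eq_mk_rep κ.toLinearMap κ.injective Λ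

theorem IsInvariantDifferential.range_inclusionK_evenDiff (hη : IsInvariantDifferential η)
    (hκ : ∀ c, (κ c : RatDiff fQ fE) = linearRatio fQ fE 3 c • η)
    (h2 : (2 : F) ≠ 0) (hQ : fQ.IsHomogeneous 2) (hE : fE.IsHomogeneous 3)
    (hsm : IsSmoothPlaneCurve fE) :
    Set.range (inclusionK fQ fE (evenDiff fQ fE)) =
      {Projectivization.map κ.toLinearMap κ.injective planeH} := by
  ext P
  refine (mem_range_map_subtype (evenDiff fQ fE) P).trans ?_
  obtain ⟨d, hd⟩ := κ.surjective P.rep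
  rw [← hd, hη.mem_evenDiff hκ h2 hQ hE hsm, Set.mem_singleton_iff, Submodule.mem_span_singleton,
    planeH, Projectivization.map_mk, eq_mk_iff]
  refine exists_congr fun a => ?_
  rw [← hd, LinearEquiv.coe_coe, ← map_smul, κ.injective.eq_iff]

theorem IsInvariantDifferential.range_inclusionK_oddDiff (hη : IsInvariantDifferential η)
    (hκ : ∀ c, (κ c : RatDiff fQ fE) = linearRatio fQ fE 3 c • η)
    (h2 : (2 : F) ≠ 0) (hQ : fQ.IsHomogeneous 2) (hE : fE.IsHomogeneous 3)
    (hsm : IsSmoothPlaneCurve fE) :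
    Set.range (inclusionK fQ fE (oddDiff fQ fE)) =
      Projectivization.map κ.toLinearMap κ.injective '' planesThroughVertex := by
  have hΛ : ∀ Λ : ℙ F (Fin 4 → F),
      (Projectivization.map κ.toLinearMap κ.injective Λ).rep ∈ oddDiff fQ fE ↔
        Λ ∈ planesThroughVertex := fun Λ => by
    rw [map_mk_rep_eq, rep_mk_mem_iff, hη.mem_oddDiff hκ h2 hQ hE hsm, planesThroughVertex]
    simp [Pi.single_apply]
  ext P
  refine (mem_range_map_subtype (oddDiff fQ fE) P).trans ?_
  constructor
  · intro h
    obtain ⟨d, hd⟩ := κ.surjective P.rep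
    have hd0 : d ≠ 0 := by
      rintro rfl
      exact P.rep_nonzero (by rw [← hd, map_zero])
    have hP : Projectivization.map κ.toLinearMap κ.injective (Projectivization.mk F d hd0) = P := by
      conv_rhs => rw [← P.mk_rep]
      rw [Projectivization.map_mk]
      congr 1
    exact ⟨_, (hΛ _).mp (hP ▸ h), hP⟩
  · rintro ⟨Λ, h, rfl⟩
    exact (hΛ Λ).mpr h

theorem IsInvariantDifferential.isPhi_iff (hη : IsInvariantDifferential η)
    (hκ : ∀ c, (κ c : RatDiff fQ fE) = linearRatio fQ fE 3 c • η)
    (h2 : (2 : F) ≠ 0) (hQ : fQ.IsHomogeneous 2) (hE : fE.IsHomogeneous 3)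
    (hsm : IsSmoothPlaneCurve fE) {e : (Fin 3 → F) ≃ₗ[F] oddDiff fQ fE}
    (he : ∀ c, (e c : globalDiff fQ fE) = κ (extendForm F c))
    (L : ℙ F (Fin 3 → F)) (P : ℙ F (oddDiff fQ fE)) :
    IsPhi fQ fE L P ↔ P = Projectivization.map e.toLinearMap e.injective L := by
  have h := hη.canonicalDivisor_eq_iff hκ h2 hQ hE hsm (inclusionK fQ fE (oddDiff fQ fE) P)
    (extendForm_ne_zero L.rep_nonzero)
  rw [← lineSectionPullback_eq] at h
  exact h.trans (map_subtype_eq_mk_iff e.toLinearMap e.injective L _ (he L.rep) P)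

end Identification

end CanonicalModel

theorem mainTheorem8 {F : Type*} [Field F] (h2 : (2 : F) ≠ 0) (h3 : (3 : F) ≠ 0)
    (fQ fE : MvPolynomial (Fin 3) F) (hQ : fQ.IsHomogeneous 2) (hE : fE.IsHomogeneous 3)
    (hsm : CanonicalModel.IsSmoothPlaneCurve fE)
    [hY : (CanonicalModel.idealY fQ fE).IsPrime] :
    -- if `Y` is smooth, the canonical sheaf is the sheaf of Kähler differentials
    (CanonicalModel.IsSmoothY fQ fE → ∀ i,
      CanonicalModel.canonicalSections fQ fE i =
        CanonicalModel.kaehlerImage (CanonicalModel.chartY fQ fE i)) ∧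
    -- the even differentials
    Module.finrank F (CanonicalModel.evenDiff fQ fE) = 1 ∧
    (∀ P : ℙ F (CanonicalModel.evenDiff fQ fE),
      CanonicalModel.canonicalDivisor fQ fE
        (CanonicalModel.inclusionK fQ fE (CanonicalModel.evenDiff fQ fE) P) =
          CanonicalModel.ramification fQ fE) ∧
    -- the odd differentials
    Module.finrank F (CanonicalModel.oddDiff fQ fE) = 3 ∧
    -- the identification of the dual of `ℙ³` with `|K_Y|` given by plane sections
    (∃ κ : (Fin 4 → F) ≃ₗ[F] CanonicalModel.globalDiff fQ fE,
      (∀ (Λ : ℙ F (Fin 4 → F)) (P : ℙ F (CanonicalModel.globalDiff fQ fE)),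
        CanonicalModel.canonicalDivisor fQ fE P = CanonicalModel.planeSection fQ fE Λ.rep ↔
          P = Projectivization.map κ.toLinearMap κ.injective Λ) ∧
      Set.range (CanonicalModel.inclusionK fQ fE (CanonicalModel.evenDiff fQ fE)) =
        {Projectivization.map κ.toLinearMap κ.injective CanonicalModel.planeH} ∧
      Set.range (CanonicalModel.inclusionK fQ fE (CanonicalModel.oddDiff fQ fE)) =
        Projectivization.map κ.toLinearMap κ.injective ''
          CanonicalModel.planesThroughVertex) ∧
    -- the isomorphism `φ_Y`
    (∃ e : (Fin 3 → F) ≃ₗ[F] CanonicalModel.oddDiff fQ fE,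
      ∀ (L : ℙ F (Fin 3 → F)) (P : ℙ F (CanonicalModel.oddDiff fQ fE)),
        CanonicalModel.IsPhi fQ fE L P ↔
          P = Projectivization.map e.toLinearMap e.injective L) := by
  obtain ⟨η, hη⟩ := CanonicalModel.exists_isInvariantDifferential (fQ := fQ) h2 hQ hE hsm
  refine (hη.exists_linearEquiv h2 hQ hE hsm).elim fun κ hκ => ?_
  refine (hη.exists_linearEquiv_oddDiff hκ h2 hQ hE hsm).elim fun e he => ?_
  have heven := hη.range_inclusionK_evenDiff hκ h2 hQ hE hsm
  refine ⟨fun hsY i => hη.canonicalSections_eq_kaehlerImage h2 hQ hE hsm hsY i,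
    hη.finrank_evenDiff hκ h2 hQ hE hsm, fun P => ?_, ?_,
    ⟨κ, fun Λ P => ?_, heven, hη.range_inclusionK_oddDiff hκ h2 hQ hE hsm⟩,
    ⟨e, fun L P => hη.isPhi_iff hκ h2 hQ hE hsm he L P⟩⟩
  · have hP := heven.le (Set.mem_range_self P)
    rw [CanonicalModel.ramification_eq h2 hQ hE,
      hη.canonicalDivisor_eq_iff hκ h2 hQ hE hsm _ (by simp)]
    exact hP
  · rw [← e.finrank_eq, Module.finrank_fin_fun]
  · rw [CanonicalModel.map_mk_rep_eq]
    exact hη.canonicalDivisor_eq_iff hκ h2 hQ hE hsm P Λ.rep_nonzero
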